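/- Let $n\ge 1$ and let $\theta:[0,\infty)\to(0,\infty)$ be a decreasing (i.e. non-increasing) function with $\theta(t)\to0$ as $t\to\infty$ and $\int_1^\infty \theta(t)\,t^{-1}\,dt<\infty$. For functions $f,g$ on $\mathbb C^n$ let $$f\times g(z)=\int_{\mathbb C^n} f(z-w)\,g(w)\,e^{\frac i2\operatorname{Im}(z\cdot\bar w)}\,dw$$ be their twisted convolution, where $z\cdot\bar w=\sum_j z_j\bar w_j$ and $dw$ is Lebesgue measure, and for $k\in\mathbb N=\{0,1,2,\dots\}$ let $\varphi_k^{n-1}(z)=L_k^{n-1}\big(\tfrac12|z|^2\big)e^{-\frac14|z|^2}$, where $L_k^{n-1}$ is the Laguerre polynomial of degree $k$ and type $n-1$. For $\delta>0$ put $\theta_\delta(t)=\delta\,\theta(\delta t)$, $t\ge 0$; this function is again positive, decreasing, vanishes at infinity and satisfies $\int_1^\infty\theta_\delta(t)\,t^{-1}\,dt<\infty$. Then for each $\delta>0$ there is a radial function $g_\delta\in L^1(\mathbb C^n)$ whose (closed) support is contained in the ball $B(0,\delta)=\{z:|z|<\delta\}$, such that (i) for every $f\in L^1(\mathbb C^n)$,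 $f\times g_\delta\to f$ in $L^1(\mathbb C^n)$ as $\delta\to0^+$; (ii) for every $\delta>0$ there is a constant $C>0$ such that $$\|g_\delta\times\varphi_k^{n-1}\|_2\le C\,e^{-\sqrt{2k+n}\;\theta_\delta(\sqrt{2k+n})}\qquad\text{for all }k\in\mathbb N .$$ -/

import Mathlib

open MeasureTheory Filter Topology

/-- The Hermitian pairing `z · w̄ = ∑ⱼ zⱼ w̄ⱼ` on `ℂⁿ`. -/
noncomputable def hermitianDot {n : ℕ} (z w : EuclideanSpace ℂ (Fin n)) : ℂ :=
  ∑ j, z j * (starRingEnd ℂ) (w j)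

/-- Twisted convolution `(f × g)(z) = ∫ f(z - w) g(w) e^{(i/2) Im (z · w̄)} dw` on `ℂⁿ`, with
respect to Lebesgue measure on `ℂⁿ = ℝ²ⁿ`. -/
noncomputable def twistedConv {n : ℕ} (f g : EuclideanSpace ℂ (Fin n) → ℂ) :
    EuclideanSpace ℂ (Fin n) → ℂ :=
  fun z => ∫ w, f (z - w) * g w * Complex.exp (Complex.I / 2 * ((hermitianDot z w).im : ℂ))

/-- The Laguerre polynomial of type `a` and degree `k`,
`L_k^a(t) = ∑_{j = 0}^{k} (-1)^j (k + a choose k - j) t^j / j!`. -/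
noncomputable def laguerrePoly (a k : ℕ) (t : ℝ) : ℝ :=
  ∑ j ∈ Finset.range (k + 1),
    (-1 : ℝ) ^ j * ((k + a).choose (k - j) : ℝ) * t ^ j / (j.factorial : ℝ)

/-- The Laguerre function `φ_k^{n-1}(z) = L_k^{n-1}(|z|² / 2) e^{-|z|² / 4}` on `ℂⁿ`, `n ≥ 1`. -/
noncomputable def laguerreFun (n k : ℕ) (z : EuclideanSpace ℂ (Fin n)) : ℂ :=
  ((laguerrePoly (n - 1) k (‖z‖ ^ 2 / 2) * Real.exp (-(‖z‖ ^ 2 / 4)) : ℝ) : ℂ)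

/-- `θ` is a positive decreasing function on `[0, ∞)`, vanishing at infinity, with
`∫₁^∞ θ(t) t⁻¹ dt < ∞`. -/
structure IsInghamWeight (θ : ℝ → ℝ) : Prop where
  pos : ∀ t, 0 ≤ t → 0 < θ t
  antitoneOn : AntitoneOn θ (Set.Ici 0)
  tendsto_zero : Tendsto θ atTop (𝓝 0)
  integrableOn : IntegrableOn (fun t => θ t * t⁻¹) (Set.Ioi 1)

/-- A function on `ℂⁿ` is radial if it depends only on `|z|`. -/
def IsRadial {n : ℕ} (g : EuclideanSpace ℂ (Fin n) → ℂ) : Prop :=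
  ∀ z w, ‖z‖ = ‖w‖ → g z = g w

/-! ### Symplectic form and integration by parts for the twisted convolution -/

section TwistedIntegrationByParts

variable {n : ℕ}

/-! The decay comes from the twisted Laplacian. In the variable `s = |z|²` it acts on profiles as `f
↦ -4 s f'' - 4 n f' + (s/4) f`, and the Laguerre function `φ_k` is an eigenfunction with eigenvalue
`2k + n`. It can be moved across the twisted convolution of radial functions
(`twistedConv_radialTwistedLaplacian`), so `(2k + n)^m (g × φ_k) = (Δ̃^m g) × φ_k`, where `Δ̃` is
this operator. Young's inequality then gives `‖g × φ_k‖₂ ≤ (2k + n)^{-m} ‖Δ̃^m g‖₁ ‖φ_k‖₂` for every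
`m`, and `‖φ_k‖₂` grows at most like `t^n`, where `t = √(2k + n)`.

It remains to find a bump `ψ` for which a good `m` exists at each dyadic scale `2^q ≤ t < 2^(q+1)`.
With `m ≈ 2^q θ(2^q) + n q`, a bound `|Δ̃^m ψ| ≤ (e^{-2} 4^q)^m` suffices: dividing by `t^{2m} ≥
4^{qm}` leaves `e^{-2m}`, which pays both for `e^{-tθ(t)}` and for `t^n`.

Such a `ψ` is a Denjoy–Carleman type construction (`exists_contDiff_iteratedDeriv_le`): a fixed bump
is averaged `N = 2m` times over intervals of length `a ≈ 2^{-q}`, for all large `q`. Each average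
can absorb one derivative at the price of a factor `2/a`, and spreads the support by `a`. The total
spread is comparable to `∑ θ(2^q) + ∑ (1 + n q) 2^{-q}`; it is finite because, by Cauchy
condensation, `∑ θ(2^q)` converges when `∫ θ(t)/t dt` does. Starting at a large `q` makes the spread
as small as desired.

Applying this to each dilated weight and normalizing gives nonnegative functions of integral one
concentrating at the origin. Such functions form an approximate identity, since twisted translations
are continuous on `L¹`. -/

/-- The symplectic form `Im (z · w̄)`. -/
noncomputable def symp (z w : EuclideanSpace ℂ (Fin n)) : ℝ := (hermitianDot z w).im

theorem symp_eq_sum (z w : EuclideanSpace ℂ (Fin n)) :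
    symp z w = ∑ j, ((z j).im * (w j).re - (z j).re * (w j).im) := by
  simp only [symp, hermitianDot, Complex.im_sum]
  refine Finset.sum_congr rfl fun j _ => ?_
  simp [Complex.mul_im]
  ring

theorem symp_sub_left (x y w : EuclideanSpace ℂ (Fin n)) :
    symp (x - y) w = symp x w - symp y w := by
  simp only [symp_eq_sum, ← Finset.sum_sub_distrib]
  refine Finset.sum_congr rfl fun j _ => ?_
  simp
  ring

theorem symp_add_right (x y w : EuclideanSpace ℂ (Fin n)) :
    symp x (y + w) = symp x y + symp x w := by
  simp only [symp_eq_sum, ← Finset.sum_add_distrib]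
  refine Finset.sum_congr rfl fun j _ => ?_
  simp
  ring

theorem symp_sub_right (x y w : EuclideanSpace ℂ (Fin n)) :
    symp x (y - w) = symp x y - symp x w := by
  simp only [symp_eq_sum, ← Finset.sum_sub_distrib]
  refine Finset.sum_congr rfl fun j _ => ?_
  simp
  ring

theorem symp_smul_right (t : ℝ) (x y : EuclideanSpace ℂ (Fin n)) :
    symp x (t • y) = t * symp x y := by
  simp only [symp_eq_sum, Finset.mul_sum]
  refine Finset.sum_congr rfl fun j _ => ?_
  simp
  ring

theorem symp_self (x : EuclideanSpace ℂ (Fin n)) : symp x x = 0 := by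
  simp only [symp_eq_sum]
  refine Finset.sum_eq_zero fun j _ => ?_
  ring

theorem symp_comm (x y : EuclideanSpace ℂ (Fin n)) : symp x y = -symp y x := by
  simp only [symp_eq_sum, ← Finset.sum_neg_distrib]
  refine Finset.sum_congr rfl fun j _ => ?_
  ring

theorem symp_zero_right (x : EuclideanSpace ℂ (Fin n)) : symp x 0 = 0 := by
  simp [symp_eq_sum]

theorem continuous_symp : Continuous fun p : EuclideanSpace ℂ (Fin n) × EuclideanSpace ℂ (Fin n) =>
    symp p.1 p.2 := by
  simp only [symp_eq_sum]
  fun_prop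

@[fun_prop]
theorem Continuous.symp {X : Type*} [TopologicalSpace X] {f g : X → EuclideanSpace ℂ (Fin n)}
    (hf : Continuous f) (hg : Continuous g) : Continuous fun x => symp (f x) (g x) :=
  continuous_symp.comp (hf.prodMk hg)

/-- The unimodular factor `e^{(i/2) Im (z · w̄)}`. -/
noncomputable def twistFactor (z w : EuclideanSpace ℂ (Fin n)) : ℂ :=
  Complex.exp (Complex.I / 2 * (symp z w : ℂ))

theorem twistedConv_apply (f g : EuclideanSpace ℂ (Fin n) → ℂ) (z : EuclideanSpace ℂ (Fin n)) :
    twistedConv f g z = ∫ w, f (z - w) * g w * twistFactor z w := rfl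

theorem norm_twistFactor (z w : EuclideanSpace ℂ (Fin n)) : ‖twistFactor z w‖ = 1 := by
  have : Complex.I / 2 * (symp z w : ℂ) = ((symp z w / 2 : ℝ) : ℂ) * Complex.I := by
    push_cast; ring
  rw [twistFactor, this, Complex.norm_exp_ofReal_mul_I]

@[fun_prop]
theorem Continuous.twistFactor {X : Type*} [TopologicalSpace X]
    {f g : X → EuclideanSpace ℂ (Fin n)}
    (hf : Continuous f) (hg : Continuous g) : Continuous fun x => twistFactor (f x) (g x) := by
  unfold _root_.twistFactor
  fun_prop

theorem hasLineDerivAt_twistFactor (z w v : EuclideanSpace ℂ (Fin n)) :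
    HasLineDerivAt ℝ (fun w => twistFactor z w) (Complex.I / 2 * (symp z v : ℂ) * twistFactor z w)
      w v := by
  unfold HasLineDerivAt twistFactor
  have h : HasDerivAt (fun t : ℝ => Complex.I / 2 * ((symp z w + t * symp z v : ℝ) : ℂ))
      (Complex.I / 2 * (symp z v : ℂ)) 0 := by
    have h0 : HasDerivAt (fun t : ℝ => symp z w + t * symp z v) (symp z v) 0 := by
      simpa using ((hasDerivAt_id (0 : ℝ)).mul_const (symp z v)).const_add (symp z w)
    exact h0.ofReal_comp.const_mul _
  have h1 := h.cexp
  simp only [zero_mul, add_zero] at h1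
  simp only [symp_add_right, symp_smul_right]
  convert! h1 using 1
  ring

theorem HasLineDerivAt.const_sub_comp {F : Type*} [NormedAddCommGroup F] [NormedSpace ℝ F]
    {E : Type*} [AddCommGroup E] [Module ℝ E] {G : E → F} {G' : F} {z w v : E}
    (h : HasLineDerivAt ℝ G G' (z - w) v) :
    HasLineDerivAt ℝ (fun w => G (z - w)) (-G') w v := by
  unfold HasLineDerivAt at *
  have h0 : HasDerivAt (fun t : ℝ => -t) (-1) 0 := hasDerivAt_neg 0
  have h1 := HasDerivAt.scomp (𝕜 := ℝ) (𝕜' := ℝ) (0 : ℝ) (h := fun t : ℝ => -t) (h' := -1)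
    (g₁ := fun t : ℝ => G (z - w + t • v)) (g₁' := G') (by simpa using h) h0
  convert! h1 using 1
  · funext t
    simp only [Function.comp]
    congr 1
    rw [neg_smul]; abel
  · simp

theorem HasCompactSupport.twisted_integrand {G φ : EuclideanSpace ℂ (Fin n) → ℂ}
    (hG : HasCompactSupport G) (z : EuclideanSpace ℂ (Fin n)) :
    HasCompactSupport fun w => G (z - w) * φ w * twistFactor z w := by
  have : HasCompactSupport fun w => G (z - w) :=
    hG.comp_homeomorph (Homeomorph.subLeft z)
  exact (this.mul_right).mul_right

theorem integrable_twisted_integrand {G φ : EuclideanSpace ℂ (Fin n) → ℂ}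
    (hGs : HasCompactSupport G) (hG : Continuous G) (hφ : Continuous φ)
    (z : EuclideanSpace ℂ (Fin n)) :
    Integrable fun w => G (z - w) * φ w * twistFactor z w :=
  Continuous.integrable_of_hasCompactSupport (by fun_prop) (hGs.twisted_integrand z)

/-- Integration by parts for the twisted convolution along the twisted derivatives
`∂_v ∓ (i/2) Im (v · w̄)`. -/
theorem twistedConv_twistedDeriv {G G' φ φ' : EuclideanSpace ℂ (Fin n) → ℂ}
    (v : EuclideanSpace ℂ (Fin n)) (hGs : HasCompactSupport G) (hGs' : HasCompactSupport G')
    (hGc : Continuous G) (hGc' : Continuous G') (hφc : Continuous φ) (hφc' : Continuous φ')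
    (hG : ∀ w, HasLineDerivAt ℝ G (G' w) w v) (hφ : ∀ w, HasLineDerivAt ℝ φ (φ' w) w v) :
    twistedConv G (fun w => φ' w - Complex.I / 2 * (symp v w : ℂ) * φ w) =
      twistedConv (fun w => G' w + Complex.I / 2 * (symp v w : ℂ) * G w) φ := by
  funext z
  have hu : ∀ w, HasLineDerivAt ℝ (fun w => G (z - w) * twistFactor z w)
      (-G' (z - w) * twistFactor z w +
        G (z - w) * (Complex.I / 2 * (symp z v : ℂ) * twistFactor z w)) w v := by
    intro w
    have h1 := (hG (z - w)).const_sub_comp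
    have h2 := hasLineDerivAt_twistFactor z w v
    unfold HasLineDerivAt at h1 h2 ⊢
    have h3 := h1.mul h2
    simp only [zero_smul, add_zero] at h3
    exact h3
  have hs : ∀ K : EuclideanSpace ℂ (Fin n) → ℂ, HasCompactSupport K →
      HasCompactSupport fun w => K (z - w) := fun K hK => hK.comp_homeomorph (Homeomorph.subLeft z)
  have hsG := hs G hGs
  have hsG' := hs G' hGs'
  have hs0 : HasCompactSupport fun w => G (z - w) * twistFactor z w := hsG.mul_right
  have hs1 : HasCompactSupport fun w => (-G' (z - w) * twistFactor z w +
        G (z - w) * (Complex.I / 2 * (symp z v : ℂ) * twistFactor z w)) :=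
    HasCompactSupport.add (HasCompactSupport.mul_right (hsG'.neg)) hsG.mul_right
  have i1 : Integrable fun w => (-G' (z - w) * twistFactor z w +
        G (z - w) * (Complex.I / 2 * (symp z v : ℂ) * twistFactor z w)) * φ w :=
    Continuous.integrable_of_hasCompactSupport (by fun_prop) hs1.mul_right
  have i2 : Integrable fun w => (G (z - w) * twistFactor z w) * φ' w :=
    Continuous.integrable_of_hasCompactSupport (by fun_prop) hs0.mul_right
  have i3 : Integrable fun w => (G (z - w) * twistFactor z w) * φ w :=
    Continuous.integrable_of_hasCompactSupport (by fun_prop) hs0.mul_right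
  have i4 : Integrable fun w => (G (z - w) * twistFactor z w) *
      (Complex.I / 2 * (symp v w : ℂ) * φ w) :=
    Continuous.integrable_of_hasCompactSupport (by fun_prop) hs0.mul_right
  have ibp := integral_bilinear_hasLineDerivAt_right_eq_neg_left_of_integrable
    (B := ContinuousLinearMap.mul ℝ ℂ) (μ := (volume : Measure (EuclideanSpace ℂ (Fin n))))
    (v := v) (g := φ) (g' := φ')
    i1 i2 i3
    (fun w _ => hu w) (fun w _ => hφ w)
  simp only [ContinuousLinearMap.mul_apply'] at ibp
  rw [twistedConv_apply, twistedConv_apply]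
  calc ∫ w, G (z - w) * (φ' w - Complex.I / 2 * (symp v w : ℂ) * φ w) * twistFactor z w
      = ∫ w, ((G (z - w) * twistFactor z w) * φ' w -
          (G (z - w) * twistFactor z w) * (Complex.I / 2 * (symp v w : ℂ) * φ w)) := by
        congr 1; funext w; ring
    _ = -(∫ w, (-G' (z - w) * twistFactor z w +
        G (z - w) * (Complex.I / 2 * (symp z v : ℂ) * twistFactor z w)) * φ w) -
        ∫ w, (G (z - w) * twistFactor z w) * (Complex.I / 2 * (symp v w : ℂ) * φ w) := by
        rw [integral_sub i2 i4, ibp]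
    _ = _ := by
        have hsub := integral_sub i1.neg i4
        simp only [Pi.neg_apply] at hsub
        rw [← integral_neg, ← hsub]
        congr 1; funext w
        -- The phase contributes `symp v z` and the twisted derivative of `φ` contributes `-symp v
        -- w`; together they make `symp v (z - w)`, the multiplier of `G` at its own argument.
        rw [symp_sub_right, symp_comm z v]
        push_cast
        ring

end TwistedIntegrationByParts

/-! ### The twisted Laplacian on radial functions -/

section Radial

variable {n : ℕ}

/-- The function `z ↦ f (|z|²)`, complex valued. -/
noncomputable def sqRadial (n : ℕ) (f : ℝ → ℝ) (z : EuclideanSpace ℂ (Fin n)) : ℂ :=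
  ((f (‖z‖ ^ 2) : ℝ) : ℂ)

/-- The operator on profiles induced by the twisted Laplacian `-Δ + |z|²/4` through
`f ↦ f (|z|²)`. -/
noncomputable def radialTwistedLaplacian (n : ℕ) (f : ℝ → ℝ) (s : ℝ) : ℝ :=
  -4 * s * deriv (deriv f) s - 4 * n * deriv f s + s / 4 * f s

@[fun_prop]
theorem Continuous.sqRadial {f : ℝ → ℝ} (hf : Continuous f) : Continuous (sqRadial n f) := by
  unfold _root_.sqRadial
  fun_prop

theorem hasCompactSupport_sqRadial {f : ℝ → ℝ} {R : ℝ} (hf : ∀ s, R < s → f s = 0) :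
    HasCompactSupport (sqRadial n f) := by
  refine HasCompactSupport.intro (isCompact_closedBall 0 √R) fun z hz => ?_
  have h1 : √R < ‖z‖ := by simpa using hz
  have h2 : R < ‖z‖ ^ 2 := Real.lt_sq_of_sqrt_lt h1
  simp [sqRadial, hf _ h2]

theorem deriv_eq_zero_of_Ioi {f : ℝ → ℝ} {R : ℝ} (hf : ∀ s, R < s → f s = 0) (s : ℝ)
    (hs : R < s) : deriv f s = 0 := by
  have : f =ᶠ[𝓝 s] fun _ => 0 := by
    filter_upwards [lt_mem_nhds hs] with x hx using hf x hx
  rw [this.deriv_eq, deriv_const]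

theorem hasLineDerivAt_sqRadial {f : ℝ → ℝ} (hf : Differentiable ℝ f)
    (w v : EuclideanSpace ℂ (Fin n)) :
    HasLineDerivAt ℝ (sqRadial n f) (2 * (inner ℝ v w : ℝ) * sqRadial n (deriv f) w) w v := by
  unfold HasLineDerivAt sqRadial
  have h0 : HasDerivAt (fun t : ℝ => ‖w + t • v‖ ^ 2) (2 * inner ℝ v w) 0 := by
    have h1 : (fun t : ℝ => ‖w + t • v‖ ^ 2) =
        fun t => ‖w‖ ^ 2 + t * (2 * inner ℝ v w) + t ^ 2 * ‖v‖ ^ 2 := by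
      funext t
      rw [norm_add_sq_real, inner_smul_right, norm_smul, mul_pow, Real.norm_eq_abs, sq_abs,
        real_inner_comm]
      ring
    rw [h1]
    have h2 := (((hasDerivAt_id (0 : ℝ)).mul_const (2 * inner ℝ v w)).const_add (‖w‖ ^ 2)).add
      ((hasDerivAt_pow 2 (0 : ℝ)).mul_const (‖v‖ ^ 2))
    convert! h2 using 1
    simp
  have h3 : HasDerivAt f (deriv f (‖w‖ ^ 2)) (‖w + (0 : ℝ) • v‖ ^ 2) := by
    simpa using (hf (‖w‖ ^ 2)).hasDerivAt
  have h4 := (h3.comp (0 : ℝ) h0).ofReal_comp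
  convert! h4 using 1
  push_cast
  ring

theorem hasLineDerivAt_inner (w v : EuclideanSpace ℂ (Fin n)) :
    HasLineDerivAt ℝ (fun w => ((inner ℝ v w : ℝ) : ℂ)) ((‖v‖ ^ 2 : ℝ) : ℂ) w v := by
  unfold HasLineDerivAt
  have h : (fun t : ℝ => (inner ℝ v (w + t • v) : ℝ)) = fun t => inner ℝ v w + t * ‖v‖ ^ 2 := by
    funext t
    rw [inner_add_right, inner_smul_right, real_inner_self_eq_norm_sq]
  have h1 : HasDerivAt (fun t : ℝ => (inner ℝ v (w + t • v) : ℝ)) (‖v‖ ^ 2) 0 := by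
    rw [h]
    simpa using ((hasDerivAt_id (0 : ℝ)).mul_const (‖v‖ ^ 2)).const_add (inner ℝ v w)
  exact h1.ofReal_comp

theorem hasLineDerivAt_symp (w v : EuclideanSpace ℂ (Fin n)) :
    HasLineDerivAt ℝ (fun w => ((symp v w : ℝ) : ℂ)) 0 w v := by
  unfold HasLineDerivAt
  simp only [symp_add_right, symp_smul_right, symp_self, mul_zero, add_zero]
  exact hasDerivAt_const _ _

/-- The twisted derivative `∂_v + κ Im (v · w̄)` of `f (|w|²)`. -/
noncomputable def twistedDeriv (κ : ℂ) (f : ℝ → ℝ) (v w : EuclideanSpace ℂ (Fin n)) : ℂ :=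
  2 * (inner ℝ v w : ℝ) * sqRadial n (deriv f) w + κ * (symp v w : ℂ) * sqRadial n f w

/-- The plain derivative along `v` of `twistedDeriv κ f v`. -/
noncomputable def lineDerivTwistedDeriv (κ : ℂ) (f : ℝ → ℝ) (v w : EuclideanSpace ℂ (Fin n)) : ℂ :=
  2 * ((‖v‖ ^ 2 : ℝ) : ℂ) * sqRadial n (deriv f) w +
    2 * (inner ℝ v w : ℝ) * (2 * (inner ℝ v w : ℝ) * sqRadial n (deriv (deriv f)) w) +
    κ * (symp v w : ℂ) * (2 * (inner ℝ v w : ℝ) * sqRadial n (deriv f) w)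

/-- The twisted derivative `∂_v + κ Im (v · w̄)` applied twice to `f (|w|²)`. -/
noncomputable def twistedDeriv₂ (κ : ℂ) (f : ℝ → ℝ) (v w : EuclideanSpace ℂ (Fin n)) : ℂ :=
  lineDerivTwistedDeriv κ f v w + κ * (symp v w : ℂ) * twistedDeriv κ f v w

theorem hasLineDerivAt_twistedDeriv (κ : ℂ) {f : ℝ → ℝ} (hf : Differentiable ℝ f)
    (hf' : Differentiable ℝ (deriv f)) (v w : EuclideanSpace ℂ (Fin n)) :
    HasLineDerivAt ℝ (twistedDeriv κ f v) (lineDerivTwistedDeriv κ f v w) w v := by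
  have h1 := hasLineDerivAt_inner w v
  have h2 := hasLineDerivAt_symp w v
  have h3 := hasLineDerivAt_sqRadial hf w v
  have h4 := hasLineDerivAt_sqRadial hf' w v
  unfold HasLineDerivAt at *
  have h5 := ((h1.const_mul 2).mul h4).add ((h2.const_mul κ).mul h3)
  simp only [zero_smul, add_zero] at h5
  convert! h5 using 1
  simp only [lineDerivTwistedDeriv]
  ring

/-- Two integrations by parts. The operators with `κ = ∓i/2` are left- and right-handed versions of
each other, so the sign of `κ` flips on crossing the convolution. -/
theorem twistedConv_twistedDeriv₂ {f g : ℝ → ℝ} {R : ℝ} (hf : ContDiff ℝ 2 f)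
    (hg : ContDiff ℝ 2 g) (hgs : ∀ s, R < s → g s = 0) (v : EuclideanSpace ℂ (Fin n)) :
    twistedConv (sqRadial n g) (twistedDeriv₂ (-(Complex.I / 2)) f v) =
      twistedConv (twistedDeriv₂ (Complex.I / 2) g v) (sqRadial n f) := by
  have hfd : Differentiable ℝ f := hf.differentiable (by norm_num)
  have hgd : Differentiable ℝ g := hg.differentiable (by norm_num)
  have hf1 : ContDiff ℝ 1 (deriv f) := hf.deriv'
  have hg1 : ContDiff ℝ 1 (deriv g) := hg.deriv'
  have hfd' := hf1.differentiable (by norm_num)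
  have hgd' := hg1.differentiable (by norm_num)
  have cf := hf.continuous
  have cg := hg.continuous
  have cf1 := hf1.continuous
  have cg1 := hg1.continuous
  have cf2 : Continuous (deriv (deriv f)) := hf1.continuous_deriv (by norm_num)
  have cg2 : Continuous (deriv (deriv g)) := hg1.continuous_deriv (by norm_num)
  have s0 : HasCompactSupport (sqRadial n g) := hasCompactSupport_sqRadial hgs
  have s1 : HasCompactSupport (sqRadial n (deriv g)) :=
    hasCompactSupport_sqRadial (deriv_eq_zero_of_Ioi hgs)
  have s2 : HasCompactSupport (sqRadial n (deriv (deriv g))) :=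
    hasCompactSupport_sqRadial (deriv_eq_zero_of_Ioi (deriv_eq_zero_of_Ioi hgs))
  have st : HasCompactSupport (twistedDeriv (Complex.I / 2) g v) :=
    HasCompactSupport.add s1.mul_left s0.mul_left
  have st' : HasCompactSupport (lineDerivTwistedDeriv (Complex.I / 2) g v) :=
    HasCompactSupport.add (HasCompactSupport.add s1.mul_left s2.mul_left.mul_left)
      s1.mul_left.mul_left
  have ct : ∀ κ : ℂ, ∀ h : ℝ → ℝ, Continuous h → Continuous (deriv h) →
      Continuous (twistedDeriv κ h v) := by
    intro κ h h0 h1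
    unfold twistedDeriv
    fun_prop
  have ct' : ∀ κ : ℂ, ∀ h : ℝ → ℝ, Continuous h → Continuous (deriv h) →
      Continuous (deriv (deriv h)) → Continuous (lineDerivTwistedDeriv κ h v) := by
    intro κ h h0 h1 h2
    unfold lineDerivTwistedDeriv
    fun_prop
  have e1 := twistedConv_twistedDeriv (φ := twistedDeriv (-(Complex.I / 2)) f v) v s0
    (G' := fun w => 2 * (inner ℝ v w : ℝ) * sqRadial n (deriv g) w)
    s1.mul_left (by fun_prop) (by fun_prop) (ct _ f cf cf1) (ct' (-(Complex.I / 2)) f cf cf1 cf2)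
    (fun w => hasLineDerivAt_sqRadial hgd w v)
    (fun w => hasLineDerivAt_twistedDeriv _ hfd hfd' v w)
  have e2 := twistedConv_twistedDeriv (φ := sqRadial n f) (G := twistedDeriv (Complex.I / 2) g v)
    (φ' := fun w => 2 * (inner ℝ v w : ℝ) * sqRadial n (deriv f) w) v st st'
    (ct _ g cg cg1) (ct' _ g cg cg1 cg2) (by fun_prop) (by fun_prop)
    (fun w => hasLineDerivAt_twistedDeriv _ hgd hgd' v w)
    (fun w => hasLineDerivAt_sqRadial hfd w v)
  have r1 : twistedDeriv₂ (-(Complex.I / 2)) f v = fun w =>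
      lineDerivTwistedDeriv (-(Complex.I / 2)) f v w -
        Complex.I / 2 * (symp v w : ℂ) * twistedDeriv (-(Complex.I / 2)) f v w := by
    funext w; simp only [twistedDeriv₂]; ring
  have r2 : twistedDeriv (-(Complex.I / 2)) f v = fun w =>
      2 * (inner ℝ v w : ℝ) * sqRadial n (deriv f) w -
        Complex.I / 2 * (symp v w : ℂ) * sqRadial n f w := by
    funext w; simp only [twistedDeriv]; ring
  rw [r1, e1]
  change twistedConv (twistedDeriv (Complex.I / 2) g v) _ = _
  rw [r2, e2]
  rfl

/-- For `v = e_j` and `v = i e_j` the pairs `(inner v w, symp v w)` are `(x, -y)` and `(y, x)` with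
`w_j = x + iy`. The cross terms linear in `κ` therefore cancel and only `κ²` survives, so both signs
of `κ` give the same operator on radial functions. -/
theorem sum_twistedDeriv₂ {κ : ℂ} (hκ : κ ^ 2 = -1 / 4) (f : ℝ → ℝ)
    (w : EuclideanSpace ℂ (Fin n)) :
    ∑ j, (twistedDeriv₂ κ f (EuclideanSpace.single j 1) w +
      twistedDeriv₂ κ f (EuclideanSpace.single j Complex.I) w) =
      -sqRadial n (radialTwistedLaplacian n f) w := by
  have ha : ∀ (j : Fin n) (c : ℂ), (inner ℝ (EuclideanSpace.single j c) w : ℝ) =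
      c.re * (w j).re + c.im * (w j).im := by
    intro j c
    rw [PiLp.inner_apply, Finset.sum_eq_single j]
    · simp [Complex.inner, mul_comm]
    · intro i _ hi; simp [hi]
    · simp
  have hb : ∀ (j : Fin n) (c : ℂ), symp (EuclideanSpace.single j c) w =
      c.im * (w j).re - c.re * (w j).im := by
    intro j c
    rw [symp_eq_sum, Finset.sum_eq_single j]
    · simp
    · intro i _ hi; simp [hi]
    · simp
  have hn : ‖w‖ ^ 2 = ∑ j, ((w j).re ^ 2 + (w j).im ^ 2) := by
    rw [EuclideanSpace.norm_sq_eq]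
    refine Finset.sum_congr rfl fun j _ => ?_
    rw [Complex.sq_norm, Complex.normSq_apply]; ring
  have hterm : ∀ j : Fin n, (twistedDeriv₂ κ f (EuclideanSpace.single j 1) w +
      twistedDeriv₂ κ f (EuclideanSpace.single j Complex.I) w) =
      4 * sqRadial n (deriv f) w + (((w j).re ^ 2 + (w j).im ^ 2 : ℝ) : ℂ) *
        (4 * sqRadial n (deriv (deriv f)) w - 1 / 4 * sqRadial n f w) := by
    intro j
    simp only [twistedDeriv₂, twistedDeriv, lineDerivTwistedDeriv, ha, hb,
      PiLp.norm_single, norm_one, Complex.norm_I, Complex.one_re, Complex.one_im,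
      Complex.I_re, Complex.I_im]
    push_cast
    linear_combination ((w j).re ^ 2 + (w j).im ^ 2 : ℂ) * sqRadial n f w * hκ
  rw [Finset.sum_congr rfl fun j _ => hterm j, Finset.sum_add_distrib,
    ← Finset.sum_mul _ _ (4 * sqRadial n (deriv (deriv f)) w - 1 / 4 * sqRadial n f w),
    ← Complex.ofReal_sum, ← hn]
  simp only [Finset.sum_const, Finset.card_univ, Fintype.card_fin, nsmul_eq_mul, sqRadial,
    radialTwistedLaplacian]
  push_cast
  ring

theorem continuous_twistedDeriv₂ (κ : ℂ) {f : ℝ → ℝ} (hf : ContDiff ℝ 2 f)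
    (v : EuclideanSpace ℂ (Fin n)) : Continuous (twistedDeriv₂ κ f v) := by
  have hf1 : ContDiff ℝ 1 (deriv f) := hf.deriv'
  have cf := hf.continuous
  have cf1 := hf1.continuous
  have cf2 : Continuous (deriv (deriv f)) := hf1.continuous_deriv (by norm_num)
  unfold twistedDeriv₂ twistedDeriv lineDerivTwistedDeriv
  fun_prop

theorem hasCompactSupport_twistedDeriv₂ (κ : ℂ) {g : ℝ → ℝ} {R : ℝ}
    (hgs : ∀ s, R < s → g s = 0) (v : EuclideanSpace ℂ (Fin n)) :
    HasCompactSupport (twistedDeriv₂ κ g v) := by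
  have s0 : HasCompactSupport (sqRadial n g) := hasCompactSupport_sqRadial hgs
  have s1 : HasCompactSupport (sqRadial n (deriv g)) :=
    hasCompactSupport_sqRadial (deriv_eq_zero_of_Ioi hgs)
  have s2 : HasCompactSupport (sqRadial n (deriv (deriv g))) :=
    hasCompactSupport_sqRadial (deriv_eq_zero_of_Ioi (deriv_eq_zero_of_Ioi hgs))
  exact HasCompactSupport.add (HasCompactSupport.add
    (HasCompactSupport.add s1.mul_left s2.mul_left.mul_left) s1.mul_left.mul_left)
    (HasCompactSupport.mul_left (HasCompactSupport.add s1.mul_left s0.mul_left))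

/-- The twisted Laplacian is symmetric with respect to twisted convolution of radial functions. -/
theorem twistedConv_radialTwistedLaplacian {f g : ℝ → ℝ} {R : ℝ} (hf : ContDiff ℝ 2 f)
    (hg : ContDiff ℝ 2 g) (hgs : ∀ s, R < s → g s = 0) :
    twistedConv (sqRadial n g) (sqRadial n (radialTwistedLaplacian n f)) =
      twistedConv (sqRadial n (radialTwistedLaplacian n g)) (sqRadial n f) := by
  have hκ1 : (-(Complex.I / 2)) ^ 2 = -1 / 4 := by
    rw [neg_sq, div_pow, Complex.I_sq]; norm_num
  have hκ2 : (Complex.I / 2) ^ 2 = -1 / 4 := by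
    rw [div_pow, Complex.I_sq]; norm_num
  have s0 : HasCompactSupport (sqRadial n g) := hasCompactSupport_sqRadial hgs
  have cf := hf.continuous
  have cg := hg.continuous
  funext z
  have h1 : ∀ v : EuclideanSpace ℂ (Fin n), Integrable fun w =>
      sqRadial n g (z - w) * twistedDeriv₂ (-(Complex.I / 2)) f v w * twistFactor z w :=
    fun v => integrable_twisted_integrand s0 (by fun_prop) (continuous_twistedDeriv₂ _ hf v) z
  have h2 : ∀ v : EuclideanSpace ℂ (Fin n), Integrable fun w =>
      twistedDeriv₂ (Complex.I / 2) g v (z - w) * sqRadial n f w * twistFactor z w :=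
    fun v => integrable_twisted_integrand (hasCompactSupport_twistedDeriv₂ _ hgs v)
      (continuous_twistedDeriv₂ _ hg v) (by fun_prop) z
  have h3 : ∀ v : EuclideanSpace ℂ (Fin n),
      ∫ w, sqRadial n g (z - w) * twistedDeriv₂ (-(Complex.I / 2)) f v w * twistFactor z w =
      ∫ w, twistedDeriv₂ (Complex.I / 2) g v (z - w) * sqRadial n f w * twistFactor z w :=
    fun v => congrFun (twistedConv_twistedDeriv₂ hf hg hgs v) z
  rw [twistedConv_apply, twistedConv_apply, ← neg_inj, ← integral_neg, ← integral_neg]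
  calc ∫ w, -(sqRadial n g (z - w) * sqRadial n (radialTwistedLaplacian n f) w * twistFactor z w)
      = ∫ w, ∑ j : Fin n, (sqRadial n g (z - w) *
            twistedDeriv₂ (-(Complex.I / 2)) f (EuclideanSpace.single j 1) w * twistFactor z w +
          sqRadial n g (z - w) *
            twistedDeriv₂ (-(Complex.I / 2)) f (EuclideanSpace.single j Complex.I) w *
            twistFactor z w) := by
        congr 1; funext w
        rw [← neg_mul, ← mul_neg, ← sum_twistedDeriv₂ hκ1, Finset.mul_sum, Finset.sum_mul]
        exact Finset.sum_congr rfl fun j _ => by ring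
    _ = ∫ w, ∑ j : Fin n, (twistedDeriv₂ (Complex.I / 2) g (EuclideanSpace.single j 1) (z - w) *
            sqRadial n f w * twistFactor z w +
          twistedDeriv₂ (Complex.I / 2) g (EuclideanSpace.single j Complex.I) (z - w) *
            sqRadial n f w * twistFactor z w) := by
        rw [integral_finsetSum, integral_finsetSum]
        · refine Finset.sum_congr rfl fun j _ => ?_
          rw [integral_add (h1 _) (h1 _), integral_add (h2 _) (h2 _), h3, h3]
        · exact fun j _ => (h2 _).add (h2 _)
        · exact fun j _ => (h1 _).add (h1 _)
    _ = _ := by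
        congr 1; funext w
        rw [← neg_mul, ← neg_mul, ← sum_twistedDeriv₂ hκ2, Finset.sum_mul, Finset.sum_mul]
        exact Finset.sum_congr rfl fun j _ => by ring

end Radial

/-! ### Laguerre functions: eigenvalue equation and `L²` norms -/

section Laguerre

/-- The coefficients of the Laguerre polynomial. -/
noncomputable def laguerreCoeff (a k j : ℕ) : ℝ :=
  if j ≤ k then (-1 : ℝ) ^ j * ((k + a).choose (k - j) : ℝ) / (j.factorial : ℝ) else 0

theorem laguerreCoeff_eq {a k j : ℕ} (hj : j ≤ k) : laguerreCoeff a k j =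
    (-1 : ℝ) ^ j * ((k + a).factorial / ((k - j).factorial * (a + j).factorial * j.factorial)) := by
  rw [laguerreCoeff, if_pos hj, Nat.cast_choose ℝ (by omega : k - j ≤ k + a),
    show k + a - (k - j) = a + j by omega]
  have := Nat.factorial_ne_zero (k - j)
  have := Nat.factorial_ne_zero (a + j)
  have := Nat.factorial_ne_zero j
  field_simp

/-- This is the Laguerre equation read coefficientwise. Extending the coefficients by zero keeps it
true for every `j`, because `j - k` vanishes exactly where they stop. -/
theorem laguerreCoeff_succ (a k j : ℕ) :
    ((j : ℝ) + 1) * (j + a + 1) * laguerreCoeff a k (j + 1) = (j - k) * laguerreCoeff a k j := by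
  rcases lt_trichotomy j k with h | h | h
  · rw [laguerreCoeff_eq (by omega : j + 1 ≤ k), laguerreCoeff_eq h.le]
    obtain ⟨d, rfl⟩ := Nat.exists_eq_add_of_lt h
    rw [show j + d + 1 - (j + 1) = d by omega, show j + d + 1 - j = d + 1 by omega,
      show a + (j + 1) = a + j + 1 by omega, Nat.factorial_succ (a + j), Nat.factorial_succ j,
      Nat.factorial_succ d]
    have := Nat.factorial_ne_zero d
    have := Nat.factorial_ne_zero (a + j)
    have := Nat.factorial_ne_zero j
    have h1 : (j : ℝ) + 1 ≠ 0 := by positivity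
    have h2 : (d : ℝ) + 1 ≠ 0 := by positivity
    have h3 : (a : ℝ) + j + 1 ≠ 0 := by positivity
    push_cast
    field_simp
    ring
  · subst h
    simp [laguerreCoeff]
  · simp [laguerreCoeff, show ¬ j + 1 ≤ k by omega, show ¬ j ≤ k by omega]

open Polynomial in
/-- The Laguerre polynomial as a formal polynomial. -/
noncomputable def laguerrePolynomial (a k : ℕ) : ℝ[X] :=
  ∑ j ∈ Finset.range (k + 1), C (laguerreCoeff a k j) * X ^ j

open Polynomial in
theorem coeff_laguerrePolynomial (a k j : ℕ) :
    (laguerrePolynomial a k).coeff j = laguerreCoeff a k j := by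
  rw [laguerrePolynomial, finsetSum_coeff]
  simp only [coeff_C_mul_X_pow]
  rw [Finset.sum_ite_eq]
  split_ifs with h
  · rfl
  · rw [laguerreCoeff, if_neg (by simpa [Nat.lt_succ_iff] using h)]

theorem eval_laguerrePolynomial (a k : ℕ) (t : ℝ) :
    (laguerrePolynomial a k).eval t = laguerrePoly a k t := by
  rw [laguerrePolynomial, laguerrePoly, Polynomial.eval_finsetSum]
  refine Finset.sum_congr rfl fun j hj => ?_
  rw [laguerreCoeff, if_pos (by simpa [Nat.lt_succ_iff] using hj)]
  simp
  ring

theorem laguerrePoly_eq_sum (a k : ℕ) (t : ℝ) :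
    laguerrePoly a k t = ∑ j ∈ Finset.range (k + 1), laguerreCoeff a k j * t ^ j := by
  rw [← eval_laguerrePolynomial, laguerrePolynomial, Polynomial.eval_finsetSum]
  simp

open Polynomial in
/-- The Laguerre differential equation. -/
theorem laguerrePolynomial_ode (a k : ℕ) :
    X * derivative (derivative (laguerrePolynomial a k)) +
      (C ((a : ℝ) + 1) - X) * derivative (laguerrePolynomial a k) +
      C (k : ℝ) * laguerrePolynomial a k = 0 := by
  ext j
  rw [sub_mul]
  simp only [coeff_add, coeff_sub, coeff_C_mul, coeff_derivative, coeff_zero]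
  rcases j with _ | j
  · simp only [coeff_X_mul_zero, coeff_laguerrePolynomial]
    have := laguerreCoeff_succ a k 0
    push_cast at this ⊢
    linear_combination this
  · simp only [coeff_X_mul, coeff_derivative, coeff_laguerrePolynomial]
    have := laguerreCoeff_succ a k (j + 1)
    push_cast at this ⊢
    linear_combination this

/-- The profile of the Laguerre function in the variable `|z|²`. -/
noncomputable def laguerreProfile (n k : ℕ) (s : ℝ) : ℝ :=
  laguerrePoly (n - 1) k (s / 2) * Real.exp (-(s / 4))

theorem laguerreFun_eq_sqRadial (n k : ℕ) : laguerreFun n k = sqRadial n (laguerreProfile n k) := rfl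

theorem contDiff_laguerreProfile (n k : ℕ) {m : WithTop ℕ∞} :
    ContDiff ℝ m (laguerreProfile n k) := by
  unfold laguerreProfile laguerrePoly
  fun_prop

/-- Polynomials in `s / 2` times `e^{-s/4}` are closed under differentiation, so the second
derivative comes from a second application to the new polynomial. -/
theorem hasDerivAt_eval_mul_exp (p : Polynomial ℝ) (s : ℝ) :
    HasDerivAt (fun s => p.eval (s / 2) * Real.exp (-(s / 4)))
      ((Polynomial.C (1 / 2) * Polynomial.derivative p - Polynomial.C (1 / 4) * p).eval (s / 2) *
        Real.exp (-(s / 4))) s := by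
  have h1 : HasDerivAt (fun s : ℝ => p.eval (s / 2))
      ((Polynomial.derivative p).eval (s / 2) * (1 / 2)) s :=
    (p.hasDerivAt (s / 2)).comp s (h := fun s : ℝ => s / 2) ((hasDerivAt_id s).div_const 2)
  have h2 : HasDerivAt (fun s : ℝ => Real.exp (-(s / 4))) (Real.exp (-(s / 4)) * (-(1 / 4))) s :=
    ((hasDerivAt_id s).div_const 4).neg.exp
  convert! h1.mul h2 using 1
  simp
  ring

/-- The Laguerre functions are eigenfunctions of the twisted Laplacian. -/
theorem radialTwistedLaplacian_laguerreProfile {n : ℕ} (hn : 1 ≤ n) (k : ℕ) :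
    radialTwistedLaplacian n (laguerreProfile n k) =
      fun s => (2 * (k : ℝ) + n) * laguerreProfile n k s := by
  obtain ⟨a, rfl⟩ : ∃ a, n = a + 1 := ⟨n - 1, by omega⟩
  have e : laguerreProfile (a + 1) k =
      fun s => (laguerrePolynomial a k).eval (s / 2) * Real.exp (-(s / 4)) := by
    funext s
    rw [eval_laguerrePolynomial]; rfl
  funext s
  have ode := congrArg (Polynomial.eval (s / 2)) (laguerrePolynomial_ode a k)
  have hd : ∀ p : Polynomial ℝ, deriv (fun s => p.eval (s / 2) * Real.exp (-(s / 4))) = _ :=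
    fun p => funext fun s => (hasDerivAt_eval_mul_exp p s).deriv
  simp only [radialTwistedLaplacian, e, hd]
  simp at ode ⊢
  -- The potential `s/4` cancels against the second derivative of the exponential; what is left is
  -- `-2` times the Laguerre equation at `s / 2`, with the additive `n` coming from the first-order
  -- term.
  linear_combination (-2 * Real.exp (-(s / 4))) * ode

/-- Orthogonality of `L_k^a` to lower powers under `t^a e^{-t}`. The quotient `(i+j+a)! / (a+i)!` is
a monic polynomial of degree `j` in `i`, and `laguerreCoeff a k i * (a+i)!` is a signed binomial
coefficient up to a constant, so the sum is a multiple of a `k`-th finite difference. -/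
theorem sum_laguerreCoeff_mul_factorial (a k j : ℕ) (hj : j ≤ k) :
    ∑ i ∈ Finset.range (k + 1), laguerreCoeff a k i * ((i + j + a).factorial : ℝ) =
      if j = k then (-1 : ℝ) ^ k * (k + a).factorial else 0 := by
  set P : Polynomial ℝ := (ascPochhammer ℝ j).comp (Polynomial.X + Polynomial.C ((a : ℝ) + 1))
    with hP
  have hdeg : P.natDegree = j := by
    rw [hP, Polynomial.natDegree_comp, ascPochhammer_natDegree, Polynomial.natDegree_X_add_C, mul_one]
  have hmonic : P.leadingCoeff = 1 := by
    have : P.Monic := (monic_ascPochhammer ℝ j).comp_X_add_C _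
    exact this
  have hval : ∀ i : ℕ, ((i + j + a).factorial : ℝ) = (a + i).factorial * P.eval (i : ℝ) := by
    intro i
    have h := Nat.factorial_mul_ascFactorial (a + i) j
    rw [hP, Polynomial.eval_comp]
    simp only [Polynomial.eval_add, Polynomial.eval_X, Polynomial.eval_C]
    rw [show (i : ℝ) + ((a : ℝ) + 1) = ((a + i + 1 : ℕ) : ℝ) by push_cast; ring,
      ← ascPochhammer_eval_cast, ascPochhammer_nat_eq_ascFactorial, ← Nat.cast_mul, h]
    congr 2; omega
  have hfd : (fwdDiff (1 : ℝ))^[k] (fun x => P.eval x) 0 =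
      if j = k then (k.factorial : ℝ) else 0 := by
    split_ifs with h
    · have := congrFun (Polynomial.fwdDiff_iter_degree_eq_factorial P) 0
      rw [hdeg, hmonic, h] at this
      simpa using this
    · have := Polynomial.fwdDiff_iter_eq_zero_of_degree_lt (P := P) (n := k) (by omega)
      rw [this]; rfl
  rw [fwdDiff_iter_eq_sum_shift] at hfd
  have hk := Nat.factorial_ne_zero k
  calc ∑ i ∈ Finset.range (k + 1), laguerreCoeff a k i * ((i + j + a).factorial : ℝ)
      = ∑ i ∈ Finset.range (k + 1), ((-1 : ℝ) ^ k * (k + a).factorial / k.factorial) *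
        (((-1 : ℤ) ^ (k - i) * (k.choose i : ℤ)) • P.eval ((0 : ℝ) + i • (1 : ℝ))) := by
        refine Finset.sum_congr rfl fun i hi => ?_
        have hi' : i ≤ k := by simpa [Nat.lt_succ_iff] using hi
        rw [laguerreCoeff_eq hi', hval]
        have := Nat.factorial_ne_zero (k - i)
        have := Nat.factorial_ne_zero (a + i)
        have := Nat.factorial_ne_zero i
        have hs : (-1 : ℝ) ^ k = (-1) ^ (k - i) * (-1) ^ i := by
          rw [← pow_add]; congr 1; omega
        have hs2 : ((-1 : ℝ) ^ (k - i)) * (-1) ^ (k - i) = 1 := by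
          rw [← mul_pow]; norm_num
        simp only [zsmul_eq_mul, zero_add, nsmul_eq_mul, mul_one]
        push_cast
        rw [Nat.cast_choose ℝ hi', hs]
        field_simp
        linear_combination (-P.eval (i : ℝ)) * hs2
    _ = _ := by
        rw [← Finset.mul_sum, hfd]
        split_ifs
        · field_simp
        · simp

theorem sum_sum_laguerreCoeff (a k : ℕ) :
    ∑ i ∈ Finset.range (k + 1), ∑ j ∈ Finset.range (k + 1),
      laguerreCoeff a k i * laguerreCoeff a k j * ((i + j + a).factorial : ℝ) =
      (k + a).factorial / k.factorial := by
  rw [Finset.sum_comm]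
  have : ∀ j ∈ Finset.range (k + 1), ∑ i ∈ Finset.range (k + 1),
      laguerreCoeff a k i * laguerreCoeff a k j * ((i + j + a).factorial : ℝ) =
      if j = k then laguerreCoeff a k j * ((-1 : ℝ) ^ k * (k + a).factorial) else 0 := by
    intro j hj
    have h := sum_laguerreCoeff_mul_factorial a k j (by simpa [Nat.lt_succ_iff] using hj)
    calc _ = laguerreCoeff a k j *
          ∑ i ∈ Finset.range (k + 1), laguerreCoeff a k i * ((i + j + a).factorial : ℝ) := by
          rw [Finset.mul_sum]
          exact Finset.sum_congr rfl fun i _ => by ring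
      _ = _ := by rw [h]; split_ifs <;> simp
  rw [Finset.sum_congr rfl this, Finset.sum_ite_eq' ]
  have hs : ((-1 : ℝ) ^ k) * (-1) ^ k = 1 := by rw [← mul_pow]; norm_num
  have := Nat.factorial_ne_zero k
  simp only [Finset.mem_range, Nat.lt_succ_self, if_true, laguerreCoeff, le_refl, Nat.sub_self,
    Nat.choose_zero_right]
  push_cast
  field_simp
  linear_combination hs

theorem integral_pow_mul_exp_neg_sq_div_two (m : ℕ) :
    ∫ r in Set.Ioi (0 : ℝ), r ^ (2 * m + 1) * Real.exp (-(r ^ 2 / 2)) = 2 ^ m * m.factorial := by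
  have h := integral_rpow_mul_exp_neg_mul_rpow (p := 2) (q := 2 * m + 1) (b := 1 / 2)
    (by norm_num) (by have : (0 : ℝ) ≤ m := by positivity
                      linarith) (by norm_num)
  have e1 : ((2 * (m : ℝ) + 1) + 1) / 2 = (m : ℝ) + 1 := by ring
  have e2 : -((2 * (m : ℝ) + 1) + 1) / 2 = -((m + 1 : ℕ) : ℝ) := by push_cast; ring
  rw [e1, e2, Real.Gamma_nat_eq_factorial, Real.rpow_neg (by norm_num), Real.rpow_natCast] at h
  calc _ = ∫ x in Set.Ioi (0 : ℝ), x ^ (2 * (m : ℝ) + 1) * Real.exp (-(1 / 2) * x ^ (2 : ℝ)) := by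
        refine setIntegral_congr_fun measurableSet_Ioi fun x _ => ?_
        have : (2 * (m : ℝ) + 1) = ((2 * m + 1 : ℕ) : ℝ) := by push_cast; ring
        simp only [this, Real.rpow_natCast, Real.rpow_two]
        congr 2; ring
    _ = _ := by
        rw [h, pow_succ, one_div, inv_pow]
        field_simp

theorem integrableOn_pow_mul_exp_neg_sq_div_two (m : ℕ) :
    IntegrableOn (fun r : ℝ => r ^ m * Real.exp (-(r ^ 2 / 2))) (Set.Ioi 0) := by
  have h := integrableOn_rpow_mul_exp_neg_mul_sq (b := 1 / 2) (s := (m : ℝ)) (by norm_num)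
    (by have : (0 : ℝ) ≤ m := by positivity
        linarith)
  refine h.congr_fun (fun x _ => ?_) measurableSet_Ioi
  simp only [Real.rpow_natCast]
  congr 2; ring

theorem laguerrePoly_sq_mul_eq_sum (a k : ℕ) (r : ℝ) :
    r ^ (2 * (a + 1) - 1) * (laguerrePoly a k (r ^ 2 / 2) * Real.exp (-(r ^ 2 / 4))) ^ 2 =
      ∑ i ∈ Finset.range (k + 1), ∑ j ∈ Finset.range (k + 1),
        laguerreCoeff a k i * laguerreCoeff a k j * (1 / 2) ^ (i + j) *
          (r ^ (2 * (i + j + a) + 1) * Real.exp (-(r ^ 2 / 2))) := by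
  have he : Real.exp (-(r ^ 2 / 4)) ^ 2 = Real.exp (-(r ^ 2 / 2)) := by
    rw [← Real.exp_nat_mul]; congr 1; push_cast; ring
  rw [mul_pow, he, laguerrePoly_eq_sum, sq (∑ j ∈ _, _), Finset.sum_mul_sum, Finset.sum_mul,
    Finset.mul_sum]
  refine Finset.sum_congr rfl fun i _ => ?_
  rw [Finset.sum_mul, Finset.mul_sum]
  refine Finset.sum_congr rfl fun j _ => ?_
  rw [show 2 * (a + 1) - 1 = 2 * a + 1 by omega]
  ring

theorem integral_laguerrePoly_sq (a k : ℕ) :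
    ∫ r in Set.Ioi (0 : ℝ), r ^ (2 * (a + 1) - 1) *
      (laguerrePoly a k (r ^ 2 / 2) * Real.exp (-(r ^ 2 / 4))) ^ 2 =
      2 ^ a * ((k + a).factorial / k.factorial) := by
  simp only [laguerrePoly_sq_mul_eq_sum]
  rw [integral_finsetSum _ fun i _ => integrable_finsetSum _ fun j _ =>
    (integrableOn_pow_mul_exp_neg_sq_div_two _).const_mul _, ← sum_sum_laguerreCoeff,
    Finset.mul_sum]
  refine Finset.sum_congr rfl fun i _ => ?_
  rw [integral_finsetSum _ fun j _ =>
    (integrableOn_pow_mul_exp_neg_sq_div_two _).const_mul _, Finset.mul_sum]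
  refine Finset.sum_congr rfl fun j _ => ?_
  rw [integral_const_mul, integral_pow_mul_exp_neg_sq_div_two, pow_add 2 (i + j) a]
  have : ((1 : ℝ) / 2) ^ (i + j) * 2 ^ (i + j) = 1 := by rw [← mul_pow]; norm_num
  linear_combination laguerreCoeff a k i * laguerreCoeff a k j * 2 ^ a *
    ((i + j + a).factorial : ℝ) * this

theorem integrableOn_laguerrePoly_sq (a k : ℕ) :
    IntegrableOn (fun r : ℝ => r ^ (2 * (a + 1) - 1) *
      (laguerrePoly a k (r ^ 2 / 2) * Real.exp (-(r ^ 2 / 4))) ^ 2) (Set.Ioi 0) := by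
  simp only [laguerrePoly_sq_mul_eq_sum]
  exact integrable_finsetSum _ fun i _ => integrable_finsetSum _ fun j _ =>
    (integrableOn_pow_mul_exp_neg_sq_div_two _).const_mul _

theorem finrank_real_euclideanSpace_complex (n : ℕ) :
    Module.finrank ℝ (EuclideanSpace ℂ (Fin n)) = 2 * n := by
  rw [← Module.finrank_mul_finrank ℝ ℂ (EuclideanSpace ℂ (Fin n))]
  simp

/-- The `L²` norms of the Laguerre functions grow polynomially. -/
theorem exists_eLpNorm_laguerreFun_le {n : ℕ} (hn : 1 ≤ n) :
    ∃ C : ℝ, 0 < C ∧ ∀ k : ℕ, eLpNorm (laguerreFun n k) 2 volume ≤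
      ENNReal.ofReal (C * √(2 * (k : ℝ) + n) ^ n) := by
  obtain ⟨a, rfl⟩ : ∃ a, n = a + 1 := ⟨n - 1, by omega⟩
  set E := EuclideanSpace ℂ (Fin (a + 1))
  have hfr : Module.finrank ℝ E = 2 * (a + 1) := finrank_real_euclideanSpace_complex _
  have : Nontrivial E := Module.nontrivial_of_finrank_pos (R := ℝ) (by omega)
  set V : ℝ := (volume : Measure E).real (Metric.ball 0 1)
  set K : ℝ := (2 * (a + 1) : ℕ) * V * 2 ^ a
  have hV : 0 ≤ V := measureReal_nonneg
  have hK : 0 ≤ K := by positivity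
  refine ⟨√K + 1, by positivity, fun k => ?_⟩
  set h : ℝ → ℝ := fun r => (laguerrePoly a k (r ^ 2 / 2) * Real.exp (-(r ^ 2 / 4))) ^ 2
  have hint : Integrable fun z : E => h ‖z‖ := by
    rw [integrable_fun_norm_addHaar, hfr]
    exact integrableOn_laguerrePoly_sq a k
  have hval : ∫ z : E, h ‖z‖ = K * ((k + a).factorial / k.factorial) := by
    rw [integral_fun_norm_addHaar, hfr]
    simp only [smul_eq_mul, nsmul_eq_mul, h]
    rw [integral_laguerrePoly_sq]
    ring
  set t : ℝ := √(2 * (k : ℝ) + (a + 1 : ℕ))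
  have ht2 : t ^ 2 = 2 * (k : ℝ) + (a + 1 : ℕ) := Real.sq_sqrt (by positivity)
  have ht1 : 1 ≤ t := by
    rw [← Real.sqrt_one]
    apply Real.sqrt_le_sqrt
    push_cast
    have : (0 : ℝ) ≤ k := by positivity
    have : (0 : ℝ) ≤ a := by positivity
    linarith
  -- The quotient is a product of `a` factors, each at most `k + a ≤ t²`; one spare power of `t²`
  -- makes the exponent equal to `n = a + 1`.
  have hfac : ((k + a).factorial : ℝ) / k.factorial ≤ (t ^ (a + 1)) ^ 2 := by
    have h1 := Nat.factorial_mul_ascFactorial k a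
    have h2 : (k + 1).ascFactorial a ≤ (k + a) ^ a := by
      have := Nat.ascFactorial_le_pow_add k a
      simpa using this
    have h3 : (((k + 1).ascFactorial a : ℕ) : ℝ) ≤ ((k : ℝ) + a) ^ a := by exact_mod_cast h2
    have h4 : (k : ℝ) + a ≤ t ^ 2 := by
      rw [ht2]; push_cast
      have : (0 : ℝ) ≤ k := by positivity
      linarith
    rw [← h1]
    push_cast
    rw [mul_div_cancel_left₀ _ (by exact_mod_cast Nat.factorial_ne_zero k)]
    calc _ ≤ ((k : ℝ) + a) ^ a := h3
      _ ≤ (t ^ 2) ^ a := by gcongr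
      _ ≤ (t ^ 2) ^ (a + 1) := pow_le_pow_right₀ (by nlinarith) (by omega)
      _ = _ := by ring
  have hsq : ∀ z : E, ‖laguerreFun (a + 1) k z‖ₑ ^ (2 : ℝ) = ENNReal.ofReal (h ‖z‖) := by
    intro z
    rw [← ofReal_norm, ENNReal.ofReal_rpow_of_nonneg (norm_nonneg _) (by norm_num)]
    congr 1
    rw [Real.rpow_two, laguerreFun, Complex.norm_real, Real.norm_eq_abs, sq_abs]
    rfl
  rw [eLpNorm_eq_lintegral_rpow_enorm_toReal (by norm_num) (by norm_num)]
  simp only [ENNReal.toReal_ofNat, hsq]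
  rw [← ofReal_integral_eq_lintegral_ofReal hint (ae_of_all _ fun z => sq_nonneg _), hval,
    ENNReal.ofReal_rpow_of_nonneg (by positivity) (by norm_num), ← Real.sqrt_eq_rpow]
  apply ENNReal.ofReal_le_ofReal
  calc √(K * ((k + a).factorial / k.factorial)) ≤ √(K * (t ^ (a + 1)) ^ 2) := by
        apply Real.sqrt_le_sqrt; gcongr
    _ = √K * t ^ (a + 1) := by
        rw [Real.sqrt_mul hK, Real.sqrt_sq (by positivity)]
    _ ≤ _ := by
        have : 0 ≤ t ^ (a + 1) := by positivity
        nlinarith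

end Laguerre

/-! ### Young's inequality and decay from iterated twisted Laplacians -/

section Decay

open scoped ENNReal

variable {n : ℕ}

theorem contDiff_radialTwistedLaplacian {f : ℝ → ℝ} (hf : ContDiff ℝ (⊤ : ℕ∞) f) :
    ContDiff ℝ (⊤ : ℕ∞) (radialTwistedLaplacian n f) := by
  have h1 : ContDiff ℝ (⊤ : ℕ∞) (deriv f) := (contDiff_infty_iff_deriv.1 hf).2
  have h2 : ContDiff ℝ (⊤ : ℕ∞) (deriv (deriv f)) := (contDiff_infty_iff_deriv.1 h1).2
  unfold radialTwistedLaplacian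
  fun_prop

theorem radialTwistedLaplacian_eq_zero {f : ℝ → ℝ} {R : ℝ} (hf : ∀ s, R < s → f s = 0) (s : ℝ)
    (hs : R < s) : radialTwistedLaplacian n f s = 0 := by
  simp [radialTwistedLaplacian, hf s hs, deriv_eq_zero_of_Ioi hf s hs,
    deriv_eq_zero_of_Ioi (deriv_eq_zero_of_Ioi hf) s hs]

theorem contDiff_iterate_radialTwistedLaplacian {f : ℝ → ℝ} (hf : ContDiff ℝ (⊤ : ℕ∞) f) (m : ℕ) :
    ContDiff ℝ (⊤ : ℕ∞) ((radialTwistedLaplacian n)^[m] f) := by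
  induction m with
  | zero => exact hf
  | succ m ih =>
    rw [Function.iterate_succ_apply']
    exact contDiff_radialTwistedLaplacian ih

theorem iterate_radialTwistedLaplacian_eq_zero {f : ℝ → ℝ} {R : ℝ} (hf : ∀ s, R < s → f s = 0)
    (m : ℕ) : ∀ s, R < s → (radialTwistedLaplacian n)^[m] f s = 0 := by
  induction m with
  | zero => exact hf
  | succ m ih =>
    rw [Function.iterate_succ_apply']
    exact radialTwistedLaplacian_eq_zero ih

/-- Each copy of the operator moves onto the Laguerre function and becomes its eigenvalue. -/
theorem twistedConv_iterate_radialTwistedLaplacian (hn : 1 ≤ n) {g : ℝ → ℝ} {R : ℝ}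
    (hg : ContDiff ℝ (⊤ : ℕ∞) g) (hgs : ∀ s, R < s → g s = 0) (k m : ℕ)
    (z : EuclideanSpace ℂ (Fin n)) :
    twistedConv (sqRadial n ((radialTwistedLaplacian n)^[m] g)) (laguerreFun n k) z =
      (2 * (k : ℂ) + n) ^ m * twistedConv (sqRadial n g) (laguerreFun n k) z := by
  induction m with
  | zero => simp
  | succ m ih =>
    have hg' := contDiff_iterate_radialTwistedLaplacian (n := n) hg m
    have hle : (2 : WithTop ℕ∞) ≤ ((⊤ : ℕ∞) : WithTop ℕ∞) := by
      exact WithTop.coe_le_coe.2 le_top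
    rw [Function.iterate_succ_apply', laguerreFun_eq_sqRadial,
      ← twistedConv_radialTwistedLaplacian (contDiff_laguerreProfile n k) (hg'.of_le hle)
        (iterate_radialTwistedLaplacian_eq_zero hgs m),
      radialTwistedLaplacian_laguerreProfile hn, pow_succ', mul_assoc,
      ← laguerreFun_eq_sqRadial, ← ih, laguerreFun_eq_sqRadial, twistedConv_apply, twistedConv_apply, ← integral_const_mul]
    congr 1
    funext w
    simp only [sqRadial]
    push_cast
    ring

/-- Cauchy–Schwarz for the splitting `F H = F^{1/2} · (F^{1/2} H)`. -/
theorem lintegral_mul_sq_le {α : Type*} [MeasurableSpace α] {μ : Measure α} {F H : α → ℝ≥0∞}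
    (hF : Measurable F) (hH : Measurable H) :
    (∫⁻ x, F x * H x ∂μ) ^ (2 : ℝ) ≤ (∫⁻ x, F x ∂μ) * ∫⁻ x, F x * H x ^ (2 : ℝ) ∂μ := by
  have hconj : Real.HolderConjugate 2 2 := Real.HolderConjugate.two_two
  have h := ENNReal.lintegral_mul_le_Lp_mul_Lq μ hconj (f := fun x => F x ^ (1 / 2 : ℝ))
    (g := fun x => F x ^ (1 / 2 : ℝ) * H x) (by fun_prop) (by fun_prop)
  have e1 : ∀ x, F x ^ (1 / 2 : ℝ) * (F x ^ (1 / 2 : ℝ) * H x) = F x * H x := by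
    intro x
    rw [← mul_assoc, ← ENNReal.rpow_add_of_nonneg _ _ (by norm_num) (by norm_num)]
    norm_num
  have e2 : ∀ x, (F x ^ (1 / 2 : ℝ)) ^ (2 : ℝ) = F x := by
    intro x
    rw [← ENNReal.rpow_mul]; norm_num
  simp only [Pi.mul_apply, e1, ENNReal.mul_rpow_of_nonneg _ _ (by norm_num : (0 : ℝ) ≤ 2), e2] at h
  calc _ ≤ ((∫⁻ x, F x ∂μ) ^ (1 / 2 : ℝ) * (∫⁻ x, F x * H x ^ (2 : ℝ) ∂μ) ^ (1 / 2 : ℝ)) ^ (2 : ℝ) := by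
        gcongr
    _ = _ := by
        rw [ENNReal.mul_rpow_of_nonneg _ _ (by norm_num), ← ENNReal.rpow_mul, ← ENNReal.rpow_mul]
        norm_num

/-- Young's inequality `‖f × h‖₂ ≤ ‖f‖₁ ‖h‖₂` for the twisted convolution. -/
theorem eLpNorm_two_twistedConv_le {f h : EuclideanSpace ℂ (Fin n) → ℂ} (hf : Measurable f)
    (hh : Measurable h) :
    eLpNorm (twistedConv f h) 2 volume ≤ eLpNorm f 1 volume * eLpNorm h 2 volume := by
  have hpt : ∀ z, ‖twistedConv f h z‖ₑ ^ (2 : ℝ) ≤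
      (∫⁻ w, ‖f w‖ₑ) * ∫⁻ w, ‖f w‖ₑ * ‖h (z - w)‖ₑ ^ (2 : ℝ) := by
    intro z
    have h1 : ‖twistedConv f h z‖ₑ ≤ ∫⁻ w, ‖f w‖ₑ * ‖h (z - w)‖ₑ := by
      rw [← lintegral_sub_left_eq_self _ z]
      refine (enorm_integral_le_lintegral_enorm _).trans (lintegral_mono fun w => ?_)
      have : ‖twistFactor z w‖ₑ = 1 := by
        rw [← ofReal_norm, norm_twistFactor, ENNReal.ofReal_one]
      change ‖f (z - w) * h w * twistFactor z w‖ₑ ≤ _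
      simp [enorm_mul, this]
    exact (ENNReal.rpow_le_rpow h1 (by norm_num)).trans
      (lintegral_mul_sq_le (by fun_prop) (by fun_prop))
  rw [eLpNorm_one_eq_lintegral_enorm, eLpNorm_eq_lintegral_rpow_enorm_toReal (by norm_num)
    (by norm_num), eLpNorm_eq_lintegral_rpow_enorm_toReal (by norm_num) (by norm_num)]
  simp only [ENNReal.toReal_ofNat]
  calc (∫⁻ z, ‖twistedConv f h z‖ₑ ^ (2 : ℝ)) ^ (1 / 2 : ℝ)
      ≤ ((∫⁻ w, ‖f w‖ₑ) ^ (2 : ℝ) * ∫⁻ w, ‖h w‖ₑ ^ (2 : ℝ)) ^ (1 / 2 : ℝ) := by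
        gcongr
        refine (lintegral_mono hpt).trans_eq ?_
        rw [lintegral_const_mul _ (by fun_prop), lintegral_lintegral_swap (by fun_prop)]
        have : ∀ w, ∫⁻ z, ‖f w‖ₑ * ‖h (z - w)‖ₑ ^ (2 : ℝ) =
            ‖f w‖ₑ * ∫⁻ z, ‖h z‖ₑ ^ (2 : ℝ) := by
          intro w
          rw [lintegral_const_mul _ (by fun_prop),
            lintegral_sub_right_eq_self (fun z => ‖h z‖ₑ ^ (2 : ℝ)) w]
        simp only [this]
        rw [lintegral_mul_const _ (by fun_prop), ← mul_assoc]
        congr 1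
        rw [ENNReal.rpow_two, sq]
    _ = _ := by
        rw [ENNReal.mul_rpow_of_nonneg _ _ (by norm_num), ← ENNReal.rpow_mul]
        norm_num

theorem eLpNorm_one_sqRadial_le {f : ℝ → ℝ} {R B : ℝ} (hfs : ∀ s, R < s → f s = 0) (hB : 0 ≤ B)
    (hfB : ∀ s, |f s| ≤ B) :
    eLpNorm (sqRadial n f) 1 volume ≤ ENNReal.ofReal
      (B * (volume : Measure (EuclideanSpace ℂ (Fin n))).real (Metric.closedBall 0 √R)) := by
  rw [eLpNorm_one_eq_lintegral_enorm, ENNReal.ofReal_mul hB, ofReal_measureReal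
    (measure_closedBall_lt_top).ne, ← setLIntegral_const,
    ← lintegral_indicator Metric.isClosed_closedBall.measurableSet]
  refine lintegral_mono fun z => ?_
  by_cases hz : z ∈ Metric.closedBall (0 : EuclideanSpace ℂ (Fin n)) √R
  · rw [Set.indicator_of_mem hz, ← ofReal_norm, sqRadial, Complex.norm_real]
    exact ENNReal.ofReal_le_ofReal (hfB _)
  · have h1 : √R < ‖z‖ := by simpa using hz
    simp [sqRadial, hfs _ (Real.lt_sq_of_sqrt_lt h1)]

/-- The order `m` is free here; the decay comes from choosing it according to the size of `2k + n`.
-/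
theorem eLpNorm_twistedConv_sqRadial_le (hn : 1 ≤ n) {g : ℝ → ℝ} {R B : ℝ} {m : ℕ}
    (hg : ContDiff ℝ (⊤ : ℕ∞) g) (hgs : ∀ s, R < s → g s = 0) (hB : 0 ≤ B)
    (hgB : ∀ s, |(radialTwistedLaplacian n)^[m] g s| ≤ B) (k : ℕ) :
    eLpNorm (twistedConv (sqRadial n g) (laguerreFun n k)) 2 volume ≤ ENNReal.ofReal
      (B * (volume : Measure (EuclideanSpace ℂ (Fin n))).real (Metric.closedBall 0 √R) /
        (2 * (k : ℝ) + n) ^ m) * eLpNorm (laguerreFun n k) 2 volume := by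
  have hn' : (0 : ℝ) < n := by exact_mod_cast hn
  have hpos : (0 : ℝ) < (2 * (k : ℝ) + n) ^ m := by positivity
  have e : twistedConv (sqRadial n g) (laguerreFun n k) = (((2 * (k : ℝ) + n) ^ m)⁻¹ : ℝ) •
      twistedConv (sqRadial n ((radialTwistedLaplacian n)^[m] g)) (laguerreFun n k) := by
    funext z
    rw [Pi.smul_apply, twistedConv_iterate_radialTwistedLaplacian hn hg hgs, Complex.real_smul,
      ← mul_assoc]
    have : (((2 * (k : ℝ) + n) ^ m : ℝ) : ℂ) ≠ 0 := by exact_mod_cast hpos.ne'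
    push_cast at this ⊢
    rw [inv_mul_cancel₀ this, one_mul]
  have hc := (contDiff_iterate_radialTwistedLaplacian (n := n) hg m).continuous
  have hc' := (contDiff_laguerreProfile n k (m := 0)).continuous
  rw [e, eLpNorm_const_smul, div_eq_inv_mul, ENNReal.ofReal_mul (by positivity), mul_assoc,
    Real.enorm_of_nonneg (by positivity)]
  gcongr
  refine (eLpNorm_two_twistedConv_le hc.sqRadial.measurable ?_).trans ?_
  · rw [laguerreFun_eq_sqRadial]; exact hc'.sqRadial.measurable
  · gcongr
    exact eLpNorm_one_sqRadial_le (iterate_radialTwistedLaplacian_eq_zero hgs m) hB hgB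

end Decay

/-! ### Approximate identities for the twisted convolution -/

section ApproximateIdentity

open scoped ENNReal

variable {n : ℕ}

theorem tendsto_lintegral_translate_sub {f : EuclideanSpace ℂ (Fin n) → ℂ} (hf : Integrable f) :
    Tendsto (fun w => ∫⁻ z, ‖f (z - w) - f z‖ₑ) (𝓝 0) (𝓝 0) := by
  let E := EuclideanSpace ℂ (Fin n)
  have hf1 : MemLp f 1 (volume : Measure E) := memLp_one_iff_integrable.2 hf
  let T : E → C(E, E) := fun w => ⟨fun z => z - w, by fun_prop⟩
  have hT : Continuous T := by
    let c : C(E × E, E) := ⟨fun p => p.2 - p.1, by fun_prop⟩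
    exact c.curry.continuous
  have hTm : ∀ w, MeasurePreserving (T w) (volume : Measure E) volume := fun w =>
    measurePreserving_sub_right volume w
  have h := Filter.Tendsto.compMeasurePreservingLp (l := 𝓝 (0 : E))
    (tendsto_const_nhds (x := hf1.toLp f)) (hT.tendsto 0) hTm (hTm 0) (by norm_num)
  rw [tendsto_iff_edist_tendsto_0] at h
  simp only [Lp.toLp_compMeasurePreserving, Lp.edist_toLp_toLp, eLpNorm_one_eq_lintegral_enorm] at h
  simpa [T] using h

theorem tendsto_lintegral_twistFactor_sub_one {f : EuclideanSpace ℂ (Fin n) → ℂ}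
    (hf : Integrable f) (hm : Measurable f) :
    Tendsto (fun w => ∫⁻ z, ‖f z‖ₑ * ‖twistFactor z w - 1‖ₑ) (𝓝 0) (𝓝 0) := by
  have h := tendsto_lintegral_filter_of_dominated_convergence (μ := volume) (l := 𝓝 0)
    (F := fun w z => ‖f z‖ₑ * ‖twistFactor z w - 1‖ₑ) (f := fun _ => 0) (fun z => ‖f z‖ₑ * 2)
  rw [lintegral_zero] at h
  refine h ?_ ?_ ?_ ?_
  · refine Eventually.of_forall fun w => ?_
    have : Continuous fun z => twistFactor z w := by fun_prop
    have := this.measurable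
    fun_prop
  · refine Eventually.of_forall fun w => ae_of_all _ fun z => ?_
    gcongr
    rw [← ofReal_norm, show (2 : ℝ≥0∞) = ENNReal.ofReal 2 by simp]
    apply ENNReal.ofReal_le_ofReal
    refine (norm_sub_le _ _).trans ?_
    rw [norm_twistFactor, norm_one]; norm_num
  · rw [lintegral_mul_const _ hm.enorm]
    exact ENNReal.mul_ne_top hf.2.ne (by norm_num)
  · refine ae_of_all _ fun z => ?_
    have hc : Continuous fun w => ‖twistFactor z w - 1‖ₑ := by
      have : Continuous fun w => twistFactor z w - 1 := by fun_prop
      exact this.enorm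
    have h0 := hc.tendsto 0
    have h1 : twistFactor z 0 = 1 := by simp [twistFactor, symp_zero_right]
    rw [h1, sub_self, enorm_zero] at h0
    have := ENNReal.Tendsto.const_mul (a := ‖f z‖ₑ) h0 (Or.inr (by simp))
    simpa using this

/-- The error splits into a phase error on the translate and a plain translation error. The phase is
unchanged under `z ↦ z - w` since `symp w w = 0`, so the first part becomes an integral against the
untranslated `f`. -/
theorem tendsto_lintegral_twisted_translate_sub {f : EuclideanSpace ℂ (Fin n) → ℂ}
    (hf : Integrable f) (hm : Measurable f) :
    Tendsto (fun w => ∫⁻ z, ‖f (z - w) * twistFactor z w - f z‖ₑ) (𝓝 0) (𝓝 0) := by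
  have h := (tendsto_lintegral_twistFactor_sub_one hf hm).add (tendsto_lintegral_translate_sub hf)
  rw [add_zero] at h
  refine tendsto_of_tendsto_of_tendsto_of_le_of_le tendsto_const_nhds h (fun _ => zero_le)
    fun w => ?_
  have e : ∫⁻ z, ‖f z‖ₑ * ‖twistFactor z w - 1‖ₑ =
      ∫⁻ z, ‖f (z - w)‖ₑ * ‖twistFactor z w - 1‖ₑ := by
    rw [← lintegral_sub_right_eq_self _ w]
    congr 1; funext z
    simp only [twistFactor, symp_sub_left, symp_self, sub_zero]
  have hc : Continuous fun z => twistFactor z w := by fun_prop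
  have hcm := hc.measurable
  have hm1 : Measurable fun z => ‖f (z - w)‖ₑ * ‖twistFactor z w - 1‖ₑ := by fun_prop
  rw [e, ← lintegral_add_left hm1]
  refine lintegral_mono fun z => ?_
  rw [← enorm_mul]
  refine le_trans (le_of_eq ?_) (enorm_add_le _ _)
  congr 1; ring

/-- As `ρ` has integral one, the difference is the `ρ`-average of twisted translates of `f` minus
`f`; Tonelli then exchanges the integrals. -/
theorem eLpNorm_twistedConv_sub_le {f : EuclideanSpace ℂ (Fin n) → ℂ} (hf : Integrable f)
    (hfm : Measurable f) {ρ : EuclideanSpace ℂ (Fin n) → ℝ} (hρ : Continuous ρ)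
    (hρs : HasCompactSupport ρ) (hρ1 : ∫ w, ρ w = 1) :
    eLpNorm (twistedConv f (fun w => (ρ w : ℂ)) - f) 1 volume ≤
      ∫⁻ w, ‖ρ w‖ₑ * ∫⁻ z, ‖f (z - w) * twistFactor z w - f z‖ₑ := by
  have hc : Continuous fun p : EuclideanSpace ℂ (Fin n) × EuclideanSpace ℂ (Fin n) =>
      twistFactor p.1 p.2 := by fun_prop
  have hcm := hc.measurable
  have hρm := hρ.measurable
  have hρi : Integrable ρ := hρ.integrable_of_hasCompactSupport hρs
  obtain ⟨B, hB⟩ := hρs.exists_bound_of_continuous hρ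
  have hpt : ∀ z, ‖twistedConv f (fun w => (ρ w : ℂ)) z - f z‖ₑ ≤
      ∫⁻ w, ‖ρ w‖ₑ * ‖f (z - w) * twistFactor z w - f z‖ₑ := by
    intro z
    have i1 : Integrable fun w => f (z - w) * ρ w * twistFactor z w := by
      have h1 : Integrable fun w => f (z - w) := hf.comp_sub_left z
      have h2 : Integrable fun w => ((ρ w : ℂ) * twistFactor z w) * f (z - w) := by
        refine h1.bdd_mul (c := B) (by
          have : Continuous fun w => (ρ w : ℂ) * twistFactor z w := by fun_prop
          exact this.aestronglyMeasurable) (ae_of_all _ fun w => ?_)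
        rw [norm_mul, norm_twistFactor, mul_one, Complex.norm_real]
        exact hB w
      refine h2.congr (ae_of_all _ fun w => ?_)
      simp only
      ring
    have i2 : Integrable fun w => (ρ w : ℂ) * f z := hρi.ofReal.mul_const _
    have e2 : ∫ w, (ρ w : ℂ) * f z = f z := by
      rw [integral_mul_const, integral_complex_ofReal, hρ1]; simp
    have e3 : twistedConv f (fun w => (ρ w : ℂ)) z - f z =
        ∫ w, (f (z - w) * ρ w * twistFactor z w - ρ w * f z) := by
      rw [integral_sub i1 i2, e2, twistedConv_apply]
    rw [e3]
    refine (enorm_integral_le_lintegral_enorm _).trans (lintegral_mono fun w => le_of_eq ?_)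
    have : ‖(ρ w : ℂ)‖ₑ = ‖ρ w‖ₑ := by rw [← ofReal_norm, ← ofReal_norm, Complex.norm_real]
    rw [← this, ← enorm_mul]
    congr 1; ring
  rw [eLpNorm_one_eq_lintegral_enorm]
  refine (lintegral_mono hpt).trans_eq ?_
  rw [lintegral_lintegral_swap (by fun_prop)]
  congr 1; funext w
  rw [lintegral_const_mul _ (by fun_prop)]

/-- Nonnegative normalized functions concentrating at the origin are an approximate identity for
the twisted convolution on `L¹`. -/
theorem tendsto_eLpNorm_twistedConv_sub {ρ : ℝ → EuclideanSpace ℂ (Fin n) → ℝ}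
    (hρ : ∀ δ, 0 < δ → Continuous (ρ δ)) (hρ0 : ∀ δ, 0 < δ → ∀ w, 0 ≤ ρ δ w)
    (hρs : ∀ δ, 0 < δ → ∀ w, δ ≤ ‖w‖ → ρ δ w = 0) (hρ1 : ∀ δ, 0 < δ → ∫ w, ρ δ w = 1)
    {f : EuclideanSpace ℂ (Fin n) → ℂ} (hf : Integrable f) :
    Tendsto (fun δ : ℝ => eLpNorm (twistedConv f (fun w => (ρ δ w : ℂ)) - f) 1 volume)
      (𝓝[>] 0) (𝓝 0) := by
  -- Tonelli is applied to a genuinely measurable representative; both the convolution and the norm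
  -- see only the class of `f`.
  obtain ⟨f', hf'm, hff'⟩ : ∃ f' : EuclideanSpace ℂ (Fin n) → ℂ, Measurable f' ∧ f =ᵐ[volume] f' :=
    ⟨_, hf.aemeasurable.measurable_mk, hf.aemeasurable.ae_eq_mk⟩
  have hf'i : Integrable f' := hf.congr hff'
  have hcong : ∀ g : EuclideanSpace ℂ (Fin n) → ℂ, twistedConv f g = twistedConv f' g := by
    intro g
    funext z
    refine integral_congr_ae ?_
    have : (fun w => f (z - w)) =ᵐ[volume] fun w => f' (z - w) :=
      (quasiMeasurePreserving_sub_left volume z).ae_eq_comp hff'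
    filter_upwards [this] with w hw
    rw [hw]
  have hcong' : ∀ δ, eLpNorm (twistedConv f (fun w => (ρ δ w : ℂ)) - f) 1 volume =
      eLpNorm (twistedConv f' (fun w => (ρ δ w : ℂ)) - f') 1 volume := by
    intro δ
    rw [hcong]
    refine eLpNorm_congr_ae ?_
    filter_upwards [hff'] with z hz
    simp [hz]
  simp only [hcong']
  rw [ENNReal.tendsto_nhds_zero]
  intro ε hε
  have h := tendsto_lintegral_twisted_translate_sub hf'i hf'm
  rw [ENNReal.tendsto_nhds_zero] at h
  obtain ⟨δ₀, hδ₀, hball⟩ := Metric.eventually_nhds_iff.1 (h ε hε)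
  filter_upwards [Ioo_mem_nhdsGT hδ₀] with δ hδ
  have hs : HasCompactSupport (ρ δ) := HasCompactSupport.intro (isCompact_closedBall 0 δ) fun w hw =>
    hρs δ hδ.1 w (by have : δ < ‖w‖ := by simpa using hw
                     exact this.le)
  refine (eLpNorm_twistedConv_sub_le hf'i hf'm (hρ δ hδ.1) hs (hρ1 δ hδ.1)).trans ?_
  calc ∫⁻ w, ‖ρ δ w‖ₑ * ∫⁻ z, ‖f' (z - w) * twistFactor z w - f' z‖ₑ
      ≤ ∫⁻ w, ‖ρ δ w‖ₑ * ε := by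
        refine lintegral_mono fun w => ?_
        by_cases hw : ‖w‖ < δ₀
        · gcongr
          exact hball (by simpa using hw)
        · rw [hρs δ hδ.1 w (by linarith [hδ.2]), enorm_zero, zero_mul, zero_mul]
    _ = ε := by
        rw [lintegral_mul_const _ (hρ δ hδ.1).measurable.enorm]
        have : ∫⁻ w, ‖ρ δ w‖ₑ = 1 := by
          have e : ∀ w, ‖ρ δ w‖ₑ = ENNReal.ofReal (ρ δ w) := fun w =>
            Real.enorm_of_nonneg (hρ0 δ hδ.1 w)
          simp only [e]
          rw [← ofReal_integral_eq_lintegral_ofReal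
            ((hρ δ hδ.1).integrable_of_hasCompactSupport hs) (ae_of_all _ (hρ0 δ hδ.1)),
            hρ1 δ hδ.1, ENNReal.ofReal_one]
        rw [this, one_mul]

end ApproximateIdentity

/-! ### Bump functions with controlled derivatives, by repeated averaging -/

section NonQuasianalytic

/-- The mean of `F` over `[x - a, x]`. -/
noncomputable def leftMean (a : ℝ) (F : ℝ → ℝ) (x : ℝ) : ℝ := a⁻¹ * ∫ t in (x - a)..x, F t

theorem hasDerivAt_leftMean {F : ℝ → ℝ} (hF : Continuous F) (a x : ℝ) :
    HasDerivAt (leftMean a F) (a⁻¹ * (F x - F (x - a))) x := by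
  have h : leftMean a F = fun x => a⁻¹ * ((∫ t in (0 : ℝ)..x, F t) - ∫ t in (0 : ℝ)..(x - a), F t) := by
    funext x
    rw [leftMean, intervalIntegral.integral_interval_sub_left
      (hF.intervalIntegrable _ _) (hF.intervalIntegrable _ _)]
  have h1 : ∀ y : ℝ, HasDerivAt (fun x => ∫ t in (0 : ℝ)..x, F t) (F y) y := fun y =>
    intervalIntegral.integral_hasDerivAt_right (hF.intervalIntegrable _ _)
      hF.aestronglyMeasurable.stronglyMeasurableAtFilter hF.continuousAt
  have h2 : HasDerivAt (fun x => ∫ t in (0 : ℝ)..(x - a), F t) (F (x - a)) x :=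
    (h1 (x - a)).comp_sub_const x a
  rw [h]
  exact ((h1 x).sub h2).const_mul _

theorem leftMean_deriv {F : ℝ → ℝ} (hF : ContDiff ℝ 1 F) (a x : ℝ) :
    leftMean a (deriv F) x = a⁻¹ * (F x - F (x - a)) := by
  rw [leftMean, intervalIntegral.integral_deriv_eq_sub
    (fun t _ => (hF.differentiable (by norm_num)).differentiableAt)
    ((hF.continuous_deriv (by norm_num)).intervalIntegrable _ _)]

theorem deriv_leftMean {F : ℝ → ℝ} (hF : ContDiff ℝ 1 F) (a : ℝ) :
    deriv (leftMean a F) = leftMean a (deriv F) := by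
  funext x
  rw [(hasDerivAt_leftMean hF.continuous a x).deriv, leftMean_deriv hF]

theorem ContDiff.one_of_infty {F : ℝ → ℝ} (hF : ContDiff ℝ (⊤ : ℕ∞) F) : ContDiff ℝ 1 F :=
  hF.of_le (by exact WithTop.coe_le_coe.2 le_top)

theorem ContDiff.deriv_infty {F : ℝ → ℝ} (hF : ContDiff ℝ (⊤ : ℕ∞) F) :
    ContDiff ℝ (⊤ : ℕ∞) (deriv F) := (contDiff_infty_iff_deriv.1 hF).2

theorem ContDiff.iteratedDeriv_infty {F : ℝ → ℝ} (hF : ContDiff ℝ (⊤ : ℕ∞) F) (j : ℕ) :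
    ContDiff ℝ (⊤ : ℕ∞) (iteratedDeriv j F) := by
  induction j with
  | zero => simpa using hF
  | succ j ih => rw [iteratedDeriv_succ]; exact ih.deriv_infty

theorem contDiff_leftMean {F : ℝ → ℝ} (hF : ContDiff ℝ (⊤ : ℕ∞) F) (a : ℝ) :
    ContDiff ℝ (⊤ : ℕ∞) (leftMean a F) := by
  rw [contDiff_infty_iff_deriv]
  refine ⟨fun x => (hasDerivAt_leftMean hF.continuous a x).differentiableAt, ?_⟩
  have : deriv (leftMean a F) = fun x => a⁻¹ * (F x - F (x - a)) :=
    funext fun x => (hasDerivAt_leftMean hF.continuous a x).deriv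
  rw [this]
  fun_prop

theorem iteratedDeriv_leftMean {F : ℝ → ℝ} (hF : ContDiff ℝ (⊤ : ℕ∞) F) (a : ℝ) (j : ℕ) :
    iteratedDeriv j (leftMean a F) = leftMean a (iteratedDeriv j F) := by
  induction j with
  | zero => simp
  | succ j ih =>
    rw [iteratedDeriv_succ, ih, deriv_leftMean (hF.iteratedDeriv_infty j).one_of_infty,
      iteratedDeriv_succ]

theorem abs_leftMean_le {a M : ℝ} (ha : 0 < a) {F : ℝ → ℝ} (hF : ∀ x, |F x| ≤ M) (x : ℝ) :
    |leftMean a F x| ≤ M := by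
  have h := intervalIntegral.norm_integral_le_of_norm_le_const (a := x - a) (b := x) (f := F)
    (C := M) fun t _ => hF t
  rw [leftMean, abs_mul, abs_of_pos (inv_pos.2 ha)]
  rw [Real.norm_eq_abs, sub_sub_cancel, abs_of_pos ha] at h
  rw [inv_mul_le_iff₀ ha]
  linarith

theorem abs_leftMean_sub_le {a M : ℝ} (ha : 0 < a) {F : ℝ → ℝ} (hF : ContDiff ℝ 1 F)
    (hM : ∀ x, |deriv F x| ≤ M) (x : ℝ) : |leftMean a F x - F x| ≤ a * M := by
  have hM0 : 0 ≤ M := (abs_nonneg _).trans (hM 0)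
  have e : leftMean a F x - F x = leftMean a (fun t => F t - F x) x := by
    rw [leftMean, leftMean, intervalIntegral.integral_sub (hF.continuous.intervalIntegrable _ _)
      (continuous_const.intervalIntegrable _ _), intervalIntegral.integral_const]
    simp only [smul_eq_mul]
    field_simp
    ring
  have h := intervalIntegral.norm_integral_le_of_norm_le_const (a := x - a) (b := x)
    (f := fun t => F t - F x) (C := a * M) fun t ht => by
      rw [Set.uIoc_of_le (by linarith)] at ht
      have := Convex.norm_image_sub_le_of_norm_deriv_le (𝕜 := ℝ) (f := F) (s := Set.univ) (C := M)
        (fun y _ => (hF.differentiable (by norm_num)).differentiableAt)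
        (fun y _ => hM y) convex_univ (Set.mem_univ x) (Set.mem_univ t)
      refine this.trans ?_
      rw [mul_comm]
      gcongr
      rw [Real.norm_eq_abs, abs_le]
      constructor <;> linarith [ht.1, ht.2]
  rw [e, leftMean, abs_mul, abs_of_pos (inv_pos.2 ha)]
  rw [Real.norm_eq_abs, sub_sub_cancel, abs_of_pos ha] at h
  rw [inv_mul_le_iff₀ ha]
  linarith

theorem leftMean_eq_const {a c x : ℝ} (ha : 0 < a) {F : ℝ → ℝ}
    (hF : ∀ t ∈ Set.Icc (x - a) x, F t = c) : leftMean a F x = c := by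
  have : ∫ t in (x - a)..x, F t = ∫ t in (x - a)..x, c := by
    refine intervalIntegral.integral_congr fun t ht => ?_
    rw [Set.uIcc_of_le (by linarith)] at ht
    exact hF t ht
  rw [leftMean, this, intervalIntegral.integral_const]
  simp [ha.ne']

theorem leftMean_nonneg {a : ℝ} (ha : 0 < a) {F : ℝ → ℝ} (hF : ∀ x, 0 ≤ F x) (x : ℝ) :
    0 ≤ leftMean a F x :=
  mul_nonneg (inv_pos.2 ha).le (intervalIntegral.integral_nonneg (by linarith) fun t _ => hF t)

theorem contDiff_iterate_leftMean {F : ℝ → ℝ} (hF : ContDiff ℝ (⊤ : ℕ∞) F) (a : ℝ) (N : ℕ) :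
    ContDiff ℝ (⊤ : ℕ∞) ((leftMean a)^[N] F) := by
  induction N with
  | zero => exact hF
  | succ N ih => rw [Function.iterate_succ_apply']; exact contDiff_leftMean ih a

theorem iteratedDeriv_iterate_leftMean {F : ℝ → ℝ} (hF : ContDiff ℝ (⊤ : ℕ∞) F) (a : ℝ) (N j : ℕ) :
    iteratedDeriv j ((leftMean a)^[N] F) = (leftMean a)^[N] (iteratedDeriv j F) := by
  induction N with
  | zero => rfl
  | succ N ih =>
    rw [Function.iterate_succ_apply', iteratedDeriv_leftMean (contDiff_iterate_leftMean hF a N), ih,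
      Function.iterate_succ_apply']

theorem abs_iterate_leftMean_le {a M : ℝ} (ha : 0 < a) {F : ℝ → ℝ} (hF : ∀ x, |F x| ≤ M) (N : ℕ) :
    ∀ x, |(leftMean a)^[N] F x| ≤ M := by
  induction N with
  | zero => exact hF
  | succ N ih => rw [Function.iterate_succ_apply']; exact abs_leftMean_le ha ih

theorem iterate_leftMean_nonneg {a : ℝ} (ha : 0 < a) {F : ℝ → ℝ} (hF : ∀ x, 0 ≤ F x) (N : ℕ) :
    ∀ x, 0 ≤ (leftMean a)^[N] F x := by
  induction N with
  | zero => exact hF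
  | succ N ih => rw [Function.iterate_succ_apply']; exact leftMean_nonneg ha ih

/-- Each mean looks back a distance `a`, so `N` of them look back at most `N * a`. -/
theorem iterate_leftMean_eq_const {a c : ℝ} (ha : 0 < a) {F : ℝ → ℝ} (N : ℕ) :
    ∀ x, (∀ t ∈ Set.Icc (x - N * a) x, F t = c) → (leftMean a)^[N] F x = c := by
  induction N with
  | zero => intro x hx; exact hx x (by simp)
  | succ N ih =>
    intro x hx
    rw [Function.iterate_succ_apply']
    refine leftMean_eq_const ha fun t ht => ih t fun s hs => hx s ⟨?_, hs.2.trans ht.2⟩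
    push_cast
    linarith [hs.1, ht.1]

theorem abs_iterate_leftMean_sub_le {a M : ℝ} (ha : 0 < a) {F : ℝ → ℝ}
    (hF : ContDiff ℝ (⊤ : ℕ∞) F) (hM : ∀ x, |deriv F x| ≤ M) (N : ℕ) (x : ℝ) :
    |(leftMean a)^[N] F x - F x| ≤ N * a * M := by
  induction N with
  | zero => simp
  | succ N ih =>
    rw [Function.iterate_succ_apply']
    have hd : ∀ y, |deriv ((leftMean a)^[N] F) y| ≤ M := by
      intro y
      rw [← iteratedDeriv_one, iteratedDeriv_iterate_leftMean hF, iteratedDeriv_one]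
      exact abs_iterate_leftMean_le ha hM N y
    have h := abs_leftMean_sub_le ha (contDiff_iterate_leftMean hF a N).one_of_infty hd x
    calc _ ≤ _ := abs_sub_le _ ((leftMean a)^[N] F x) _
      _ ≤ a * M + N * a * M := add_le_add h ih
      _ = _ := by push_cast; ring

/-- One mean absorbs one derivative: the mean of `F'` is the difference quotient `(F x - F (x - a))
/ a`, bounded by `2M / a`. -/
theorem abs_iterate_leftMean_iteratedDeriv_self_le {a : ℝ} (ha : 0 < a) (j : ℕ) :
    ∀ {F : ℝ → ℝ} {M : ℝ}, ContDiff ℝ (⊤ : ℕ∞) F → (∀ x, |F x| ≤ M) →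
      ∀ x, |(leftMean a)^[j] (iteratedDeriv j F) x| ≤ (2 / a) ^ j * M := by
  induction j with
  | zero => intro F M _ hM x; simpa using hM x
  | succ j ih =>
    intro F M hF hM x
    have hb : ∀ x, |leftMean a (deriv F) x| ≤ 2 / a * M := by
      intro x
      rw [leftMean_deriv hF.one_of_infty, abs_mul, abs_of_pos (inv_pos.2 ha), div_mul_eq_mul_div,
        ← div_eq_inv_mul]
      gcongr
      calc _ ≤ |F x| + |F (x - a)| := abs_sub _ _
        _ ≤ 2 * M := by linarith [hM x, hM (x - a)]
    have h := ih (contDiff_leftMean hF.deriv_infty a) hb x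
    rw [Function.iterate_succ_apply, iteratedDeriv_succ', ← iteratedDeriv_leftMean hF.deriv_infty]
    refine h.trans_eq ?_
    ring

theorem abs_iterate_leftMean_iteratedDeriv_le {a M : ℝ} (ha : 0 < a) {F : ℝ → ℝ}
    (hF : ContDiff ℝ (⊤ : ℕ∞) F) (hM : ∀ x, |F x| ≤ M) {j N : ℕ} (hj : j ≤ N) (x : ℝ) :
    |iteratedDeriv j ((leftMean a)^[N] F) x| ≤ (2 / a) ^ j * M := by
  obtain ⟨d, rfl⟩ := Nat.exists_eq_add_of_le' hj
  rw [iteratedDeriv_iterate_leftMean hF, Function.iterate_add_apply]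
  exact abs_iterate_leftMean_le ha (abs_iterate_leftMean_iteratedDeriv_self_le ha j hF hM) d x

/-- Successive averages of `v`, with `N p` averages at scale `a p`. -/
noncomputable def meanSeq (a : ℕ → ℝ) (N : ℕ → ℕ) (v : ℝ → ℝ) : ℕ → ℝ → ℝ
  | 0 => v
  | p + 1 => (leftMean (a p))^[N p] (meanSeq a N v p)

section MeanSeq

variable {a : ℕ → ℝ} {N : ℕ → ℕ} {v : ℝ → ℝ}

theorem contDiff_meanSeq (hv : ContDiff ℝ (⊤ : ℕ∞) v) (p : ℕ) :
    ContDiff ℝ (⊤ : ℕ∞) (meanSeq a N v p) := by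
  induction p with
  | zero => exact hv
  | succ p ih => exact contDiff_iterate_leftMean ih _ _

theorem abs_iteratedDeriv_meanSeq_mono (ha : ∀ p, 0 < a p) (hv : ContDiff ℝ (⊤ : ℕ∞) v) {j q : ℕ}
    {M : ℝ} (hM : ∀ x, |iteratedDeriv j (meanSeq a N v q) x| ≤ M) {p : ℕ} (hqp : q ≤ p) (x : ℝ) :
    |iteratedDeriv j (meanSeq a N v p) x| ≤ M := by
  induction p, hqp using Nat.le_induction generalizing x with
  | base => exact hM x
  | succ p _ ih =>
    rw [meanSeq, iteratedDeriv_iterate_leftMean (contDiff_meanSeq hv p)]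
    exact abs_iterate_leftMean_le (ha p) ih _ x

theorem meanSeq_nonneg (ha : ∀ p, 0 < a p) (hv : ∀ x, 0 ≤ v x) (p : ℕ) :
    ∀ x, 0 ≤ meanSeq a N v p x := by
  induction p with
  | zero => exact hv
  | succ p ih => exact iterate_leftMean_nonneg (ha p) ih _

theorem meanSeq_eq_const (ha : ∀ p, 0 < a p) {c : ℝ} (p : ℕ) :
    ∀ x, (∀ t ∈ Set.Icc (x - ∑ q ∈ Finset.range p, N q * a q) x, v t = c) →
      meanSeq a N v p x = c := by
  induction p with
  | zero => intro x hx; exact hx x (by simp)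
  | succ p ih =>
    intro x hx
    refine iterate_leftMean_eq_const (ha p) _ x fun t ht => ih t fun s hs =>
      hx s ⟨?_, hs.2.trans ht.2⟩
    rw [Finset.sum_range_succ]
    linarith [hs.1, ht.1]

/-- Makes the averages converge with all derivatives once `∑ N p * a p` is finite. -/
theorem abs_iteratedDeriv_meanSeq_succ_sub_le (ha : ∀ p, 0 < a p) (hv : ContDiff ℝ (⊤ : ℕ∞) v)
    {j : ℕ} {M : ℝ} (hM : ∀ x, |iteratedDeriv (j + 1) v x| ≤ M) (p : ℕ) (x : ℝ) :
    |iteratedDeriv j (meanSeq a N v (p + 1) - meanSeq a N v p) x| ≤ N p * a p * M := by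
  have hp := contDiff_meanSeq (a := a) (N := N) hv p
  have hp' := contDiff_meanSeq (a := a) (N := N) hv (p + 1)
  have hle : ((j : ℕ) : WithTop ℕ∞) ≤ ((⊤ : ℕ∞) : WithTop ℕ∞) := by
    exact WithTop.coe_le_coe.2 le_top
  rw [iteratedDeriv_sub ((hp'.of_le hle).contDiffAt) ((hp.of_le hle).contDiffAt)]
  rw [meanSeq, iteratedDeriv_iterate_leftMean hp]
  refine abs_iterate_leftMean_sub_le (ha p) (hp.iteratedDeriv_infty j) (fun y => ?_) _ x
  rw [← iteratedDeriv_succ]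
  exact abs_iteratedDeriv_meanSeq_mono (q := 0) ha hv hM (Nat.zero_le p) y

end MeanSeq

/-- A compactly supported smooth function whose derivatives up to order `N p` are controlled by
powers of `2 / a p`, for every `p`. -/
theorem exists_contDiff_iteratedDeriv_le {r : ℝ} (hr : 0 < r) {a : ℕ → ℝ} {N : ℕ → ℕ}
    (ha : ∀ p, 0 < a p) (hs : Summable fun p => N p * a p) (hsum : ∑' p, N p * a p ≤ r) :
    ∃ ψ : ℝ → ℝ, ContDiff ℝ (⊤ : ℕ∞) ψ ∧ (∀ x, 0 ≤ ψ x) ∧ ψ 0 = 1 ∧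
      (∀ x, 3 * r < |x| → ψ x = 0) ∧
      ∀ p j, j ≤ N p → ∀ x, |iteratedDeriv j ψ x| ≤ (2 / a p) ^ j := by
  -- The bump is `1` on `[-r, r]` and `0` outside `(-2r, 2r)`. All averages together look back at
  -- most `r`, so the limit is still `1` at `0` and vanishes where `|x| > 3r`.
  let b : ContDiffBump (0 : ℝ) := ⟨r, 2 * r, hr, by linarith⟩
  let v : ℝ → ℝ := b
  have hv : ContDiff ℝ (⊤ : ℕ∞) v := b.contDiff
  have hv1 : ∀ x, |v x| ≤ 1 := fun x => by
    rw [abs_of_nonneg b.nonneg]; exact b.le_one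
  have hvb : ∀ j, ∃ M, ∀ x, |iteratedDeriv j v x| ≤ M := by
    intro j
    have hle : ((j : ℕ) : WithTop ℕ∞) ≤ ((⊤ : ℕ∞) : WithTop ℕ∞) := by
      exact WithTop.coe_le_coe.2 le_top
    obtain ⟨M, hM⟩ := (b.hasCompactSupport.iteratedFDeriv (𝕜 := ℝ) j).exists_bound_of_continuous
      (hv.continuous_iteratedFDeriv hle)
    exact ⟨M, fun x => by
      rw [← Real.norm_eq_abs, ← norm_iteratedFDeriv_eq_norm_iteratedDeriv]; exact hM x⟩
  choose M hM using hvb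
  set u := meanSeq a N v
  have hu : ∀ p, ContDiff ℝ (⊤ : ℕ∞) (u p) := contDiff_meanSeq hv
  let d : ℕ → ℝ → ℝ := fun p => u (p + 1) - u p
  have hd : ∀ p, ContDiff ℝ (⊤ : ℕ∞) (d p) := fun p => (hu (p + 1)).sub (hu p)
  have hdb : ∀ (j p : ℕ) (x : ℝ), (j : ℕ∞) ≤ ⊤ →
      ‖iteratedFDeriv ℝ j (d p) x‖ ≤ N p * a p * M (j + 1) := by
    intro j p x _
    rw [norm_iteratedFDeriv_eq_norm_iteratedDeriv]
    exact abs_iteratedDeriv_meanSeq_succ_sub_le ha hv (hM (j + 1)) p x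
  have hds : ∀ j : ℕ, (j : ℕ∞) ≤ ⊤ → Summable fun p => N p * a p * M (j + 1) :=
    fun j _ => hs.mul_right _
  let D : ℝ → ℝ := fun x => ∑' p, d p x
  have hD : ContDiff ℝ (⊤ : ℕ∞) D := contDiff_tsum hd hds hdb
  let ψ : ℝ → ℝ := v + D
  have hψ : ContDiff ℝ (⊤ : ℕ∞) ψ := hv.add hD
  have htend : ∀ j x, Tendsto (fun p => iteratedDeriv j (u p) x) atTop (𝓝 (iteratedDeriv j ψ x)) := by
    intro j x
    have hle : ((j : ℕ) : WithTop ℕ∞) ≤ ((⊤ : ℕ∞) : WithTop ℕ∞) := by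
      exact WithTop.coe_le_coe.2 le_top
    have hDj : iteratedDeriv j D x = ∑' p, iteratedDeriv j (d p) x := by
      have h1 := iteratedFDeriv_tsum_apply hd hds hdb (k := j) le_top x
      have hsF : Summable fun p => iteratedFDeriv ℝ j (d p) x :=
        Summable.of_norm_bounded (hds j le_top) fun p => hdb j p x le_top
      rw [iteratedDeriv_eq_iteratedFDeriv, h1]
      simp only [iteratedDeriv_eq_iteratedFDeriv]
      exact (ContinuousMultilinearMap.apply ℝ (fun _ : Fin j => ℝ) ℝ (fun _ => (1 : ℝ))).map_tsum hsF
    have hsj : Summable fun p => iteratedDeriv j (d p) x :=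
      Summable.of_norm_bounded (hds j le_top) fun p => by
        rw [← norm_iteratedFDeriv_eq_norm_iteratedDeriv]; exact hdb j p x le_top
    have h2 := (hsj.hasSum.tendsto_sum_nat).const_add (iteratedDeriv j v x)
    have h3 : iteratedDeriv j ψ x = iteratedDeriv j v x + ∑' p, iteratedDeriv j (d p) x := by
      rw [← hDj]
      exact iteratedDeriv_add (hv.of_le hle).contDiffAt (hD.of_le hle).contDiffAt
    rw [h3]
    refine h2.congr fun p => ?_
    have h4 : ∀ q, iteratedDeriv j (d q) x = iteratedDeriv j (u (q + 1)) x - iteratedDeriv j (u q) x :=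
      fun q => iteratedDeriv_sub ((hu (q + 1)).of_le hle).contDiffAt ((hu q).of_le hle).contDiffAt
    simp only [h4]
    rw [Finset.sum_range_sub fun q => iteratedDeriv j (u q) x]
    change iteratedDeriv j v x + (_ - iteratedDeriv j v x) = _
    ring
  have htend0 : ∀ x, Tendsto (fun p => u p x) atTop (𝓝 (ψ x)) := fun x => by
    simpa using htend 0 x
  have hS : ∀ p, ∑ q ∈ Finset.range p, N q * a q ≤ r := fun p =>
    (hs.sum_le_tsum _ fun q _ => mul_nonneg (Nat.cast_nonneg _) (ha q).le).trans hsum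
  have hconst : ∀ x c, (∀ t ∈ Set.Icc (x - r) x, v t = c) → ψ x = c := by
    intro x c h
    refine tendsto_nhds_unique (htend0 x) ?_
    have : (fun p => u p x) = fun _ => c := funext fun p =>
      meanSeq_eq_const ha p x fun t ht => h t ⟨by linarith [ht.1, hS p], ht.2⟩
    rw [this]
    exact tendsto_const_nhds
  refine ⟨ψ, hψ, fun x => ge_of_tendsto' (htend0 x) fun p => meanSeq_nonneg ha (fun _ => b.nonneg) p x,
    ?_, ?_, ?_⟩
  · refine hconst 0 1 fun t ht => b.one_of_mem_closedBall ?_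
    rw [Metric.mem_closedBall, dist_zero_right, Real.norm_eq_abs, abs_le]
    exact ⟨by linarith [ht.1], by linarith [ht.2, hr]⟩
  · intro x hx
    refine hconst x 0 fun t ht => b.zero_of_le_dist ?_
    rw [dist_zero_right, Real.norm_eq_abs]
    change 2 * r ≤ |t|
    rcases lt_abs.1 hx with h | h
    · exact le_abs.2 (Or.inl (by linarith [ht.1]))
    · exact le_abs.2 (Or.inr (by linarith [ht.2]))
  · intro p j hj x
    refine le_of_tendsto (htend j x).abs ?_
    -- The `N p` means at scale `a p` give the bound at stage `p + 1`, and later means cannot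
    -- increase it.
    filter_upwards [eventually_ge_atTop (p + 1)] with q hq
    refine abs_iteratedDeriv_meanSeq_mono ha hv (q := p + 1) (fun y => ?_) hq x
    have h0 : ∀ y, |u p y| ≤ 1 := fun y => by
      simpa using abs_iteratedDeriv_meanSeq_mono (a := a) (N := N) ha hv (j := 0) (q := 0) (M := 1)
        (by simpa [meanSeq] using hv1) (Nat.zero_le p) y
    have := abs_iterate_leftMean_iteratedDeriv_le (ha p) (hu p) h0 hj y
    rwa [mul_one] at this

end NonQuasianalytic

/-! ### Sup bounds for iterated twisted Laplacians -/

section IterateBounds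

variable {n : ℕ}

theorem hasDerivAt_iteratedDeriv {f : ℝ → ℝ} (hf : ContDiff ℝ (⊤ : ℕ∞) f) (j : ℕ) (s : ℝ) :
    HasDerivAt (iteratedDeriv j f) (iteratedDeriv (j + 1) f s) s := by
  rw [iteratedDeriv_succ]
  exact ((hf.iteratedDeriv_infty j).one_of_infty.differentiable (by norm_num) s).hasDerivAt

theorem iteratedDeriv_radialTwistedLaplacian {f : ℝ → ℝ} (hf : ContDiff ℝ (⊤ : ℕ∞) f) (j : ℕ) :
    iteratedDeriv j (radialTwistedLaplacian n f) = fun s =>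
      -4 * s * iteratedDeriv (j + 2) f s - 4 * (n + j) * iteratedDeriv (j + 1) f s +
        s / 4 * iteratedDeriv j f s + j / 4 * iteratedDeriv (j - 1) f s := by
  induction j with
  | zero =>
    funext s
    simp only [iteratedDeriv_zero, radialTwistedLaplacian, zero_add, iteratedDeriv_succ]
    simp
  | succ j ih =>
    rw [iteratedDeriv_succ, ih]
    funext s
    have h2 := ((hasDerivAt_id s).const_mul (-4)).mul (hasDerivAt_iteratedDeriv hf (j + 2) s)
    have h1 := (hasDerivAt_iteratedDeriv hf (j + 1) s).const_mul (4 * ((n : ℝ) + j))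
    have h0 := ((hasDerivAt_id s).div_const 4).mul (hasDerivAt_iteratedDeriv hf j s)
    have hm := (hasDerivAt_iteratedDeriv hf (j - 1) s).const_mul ((j : ℝ) / 4)
    -- At `j = 0` the truncated `j - 1 + 1` is not `j`, but the factor `j` vanishes.
    have hj : (j : ℝ) / 4 * iteratedDeriv (j - 1 + 1) f s = (j : ℝ) / 4 * iteratedDeriv j f s := by
      rcases j with _ | j
      · simp
      · simp
    have h := (((h2.sub h1).add h0).add hm).deriv
    rw [hj] at h
    refine Eq.trans (Eq.trans ?_ h) ?_
    · rfl
    · simp only [id, Nat.add_sub_cancel]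
      push_cast
      ring

theorem iteratedDeriv_eq_zero_of_abs_gt {f : ℝ → ℝ} {R : ℝ} (hfs : ∀ s, R < |s| → f s = 0) (j : ℕ)
    (s : ℝ) (hs : R < |s|) : iteratedDeriv j f s = 0 := by
  have : f =ᶠ[𝓝 s] fun _ => 0 := by
    filter_upwards [continuous_abs.continuousAt.eventually_const_lt hs] with x hx using hfs x hx
  rw [this.iteratedDeriv_eq]
  simp

theorem abs_mul_iteratedDeriv_le {f : ℝ → ℝ} {R : ℝ} (hfs : ∀ s, R < |s| → f s = 0) (hR : 0 ≤ R)
    (j : ℕ) {B : ℝ} (hB : ∀ s, |iteratedDeriv j f s| ≤ B) (s : ℝ) :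
    |s| * |iteratedDeriv j f s| ≤ R * B := by
  by_cases hs : R < |s|
  · rw [iteratedDeriv_eq_zero_of_abs_gt hfs j s hs, abs_zero, mul_zero]
    exact mul_nonneg hR ((abs_nonneg _).trans (hB s))
  · exact mul_le_mul (not_lt.1 hs) (hB s) (abs_nonneg _) hR

/-- One application costs two powers of `b` and a constant. Its summands come from `s f''`, the
first-order term, the potential, and the lower-order Leibniz term of the potential. The condition `N
≤ b` lets the factors `j` be absorbed into powers of `b`. -/
theorem abs_iteratedDeriv_radialTwistedLaplacian_le {f : ℝ → ℝ} (hf : ContDiff ℝ (⊤ : ℕ∞) f)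
    {R b K : ℝ} (hR : 0 ≤ R) (hfs : ∀ s, R < |s| → f s = 0) (hb : 1 ≤ b) (hK : 0 ≤ K) {N c : ℕ}
    (hN : (N : ℝ) ≤ b)
    (hfb : ∀ j, j + c ≤ N → ∀ s, |iteratedDeriv j f s| ≤ K * b ^ (j + c)) {j : ℕ}
    (hj : j + (c + 2) ≤ N) (s : ℝ) :
    |iteratedDeriv j (radialTwistedLaplacian n f) s| ≤
      (4 * R + 4 * (n + 1) + R / 4 + 1 / 4) * K * b ^ (j + (c + 2)) := by
  have hjb : (j : ℝ) ≤ b := le_trans (by exact_mod_cast (by omega : j ≤ N)) hN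
  have h2 := abs_mul_iteratedDeriv_le hfs hR (j + 2) (hfb (j + 2) (by omega)) s
  have h1 := hfb (j + 1) (by omega) s
  have h0 := abs_mul_iteratedDeriv_le hfs hR j (hfb j (by omega)) s
  have hm := hfb (j - 1) (by omega) s
  set P : ℝ := b ^ (j + c) with hP
  have hP0 : 0 ≤ P := by positivity
  have hm' : |iteratedDeriv (j - 1) f s| ≤ K * P :=
    hm.trans (mul_le_mul_of_nonneg_left (pow_le_pow_right₀ hb (by omega)) hK)
  rw [show j + 2 + c = j + c + 2 by omega, pow_add, ← hP] at h2
  rw [show j + 1 + c = j + c + 1 by omega, pow_add, ← hP, pow_one] at h1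
  rw [show j + (c + 2) = j + c + 2 by omega, pow_add, ← hP]
  have hKP : 0 ≤ K * P := mul_nonneg hK hP0
  have hn0 : (0 : ℝ) ≤ n := Nat.cast_nonneg n
  have hj0 : (0 : ℝ) ≤ j := Nat.cast_nonneg j
  have hbb : 1 ≤ b ^ 2 := one_le_pow₀ hb
  have t1 : (n + j : ℝ) * |iteratedDeriv (j + 1) f s| ≤ (n + 1) * (K * P * b ^ 2) := by
    calc (n + j : ℝ) * |iteratedDeriv (j + 1) f s| ≤ ((n + 1) * b) * (K * (P * b)) := by
          refine mul_le_mul ?_ h1 (abs_nonneg _) (by positivity)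
          nlinarith
      _ = _ := by ring
  have t0 : |s| * |iteratedDeriv j f s| ≤ R * (K * P * b ^ 2) :=
    h0.trans (mul_le_mul_of_nonneg_left (le_mul_of_one_le_right hKP hbb) hR)
  have tm : (j : ℝ) * |iteratedDeriv (j - 1) f s| ≤ K * P * b ^ 2 := by
    calc (j : ℝ) * |iteratedDeriv (j - 1) f s| ≤ b * (K * P) :=
          mul_le_mul hjb hm' (abs_nonneg _) (by positivity)
      _ ≤ b ^ 2 * (K * P) := by gcongr; nlinarith
      _ = _ := by ring
  rw [iteratedDeriv_radialTwistedLaplacian hf]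
  have tri : ∀ x y z w : ℝ, |x - y + z + w| ≤ |x| + |y| + |z| + |w| := fun x y z w =>
    (abs_add_le _ _).trans
      (add_le_add ((abs_add_le _ _).trans (add_le_add (abs_sub _ _) le_rfl)) le_rfl)
  refine (tri _ _ _ _).trans ?_
  have e4 : |(-4 : ℝ)| = 4 := by norm_num
  have e1 : |(4 : ℝ)| = 4 := by norm_num
  rw [abs_mul, abs_mul, e4, abs_mul, abs_mul, e1, abs_of_nonneg (add_nonneg hn0 hj0), abs_mul,
    abs_div, e1, abs_mul, abs_div, e1, abs_of_nonneg hj0]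
  linarith

theorem abs_iteratedDeriv_iterate_radialTwistedLaplacian_le {f : ℝ → ℝ}
    (hf : ContDiff ℝ (⊤ : ℕ∞) f) {R b : ℝ} (hR : 0 ≤ R) (hfs : ∀ s, R < |s| → f s = 0)
    (hb : 1 ≤ b) {N : ℕ} (hN : (N : ℝ) ≤ b)
    (hfb : ∀ j, j ≤ N → ∀ s, |iteratedDeriv j f s| ≤ b ^ j) (m : ℕ) :
    ∀ j, j + 2 * m ≤ N → ∀ s, |iteratedDeriv j ((radialTwistedLaplacian n)^[m] f) s| ≤
      (4 * R + 4 * (n + 1) + R / 4 + 1 / 4) ^ m * b ^ (j + 2 * m) := by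
  induction m with
  | zero => simpa using hfb
  | succ m ih =>
    intro j hj s
    have hz : ∀ s, R < |s| → (radialTwistedLaplacian n)^[m] f s = 0 := by
      clear ih hj
      induction m with
      | zero => exact hfs
      | succ m ih' =>
        intro s hs
        have h0 : ∀ i, iteratedDeriv i ((radialTwistedLaplacian n)^[m] f) s = 0 := fun i =>
          iteratedDeriv_eq_zero_of_abs_gt ih' i s hs
        have h1 := h0 1
        have h2 := h0 2
        rw [iteratedDeriv_one] at h1
        rw [iteratedDeriv_succ, iteratedDeriv_one] at h2
        rw [Function.iterate_succ_apply', radialTwistedLaplacian, h1, h2, ih' s hs]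
        ring
    have h := abs_iteratedDeriv_radialTwistedLaplacian_le (n := n)
      (contDiff_iterate_radialTwistedLaplacian (n := n) hf m) hR hz hb
      (K := (4 * R + 4 * (n + 1) + R / 4 + 1 / 4) ^ m) (by positivity) hN ih
      (j := j) (by omega) s
    rw [Function.iterate_succ_apply', pow_succ', mul_add 2 m 1]
    exact h

end IterateBounds

/-! ### Weights, dyadic summability and the choice of scales -/

section Weights

theorem IsInghamWeight.dilate {θ : ℝ → ℝ} (hθ : IsInghamWeight θ) {δ : ℝ} (hδ : 0 < δ) :
    IsInghamWeight fun t => δ * θ (δ * t) where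
  pos t ht := mul_pos hδ (hθ.pos _ (by positivity))
  antitoneOn s hs t ht hst := by
    have hs' : 0 ≤ s := hs
    have ht' : 0 ≤ t := ht
    exact mul_le_mul_of_nonneg_left (hθ.antitoneOn (Set.mem_Ici.2 (by positivity))
      (Set.mem_Ici.2 (by positivity)) (by gcongr)) hδ.le
  tendsto_zero := by
    have := (hθ.tendsto_zero.comp (tendsto_id.const_mul_atTop hδ)).const_mul δ
    simpa using this
  integrableOn := by
    -- The substitution moves the lower limit from `1` to `δ`; for `δ < 1` the extra piece is
    -- handled by monotonicity.
    have h1 : IntegrableOn (fun t => θ t * t⁻¹) (Set.Ioi δ) := by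
      have h2 : IntegrableOn (fun t => θ t * t⁻¹) (Set.Icc δ 1) := by
        refine AntitoneOn.integrableOn_isCompact isCompact_Icc fun s hs t ht hst => ?_
        have hs0 : 0 < s := hδ.trans_le hs.1
        have ht0 : 0 < t := hδ.trans_le ht.1
        exact mul_le_mul (hθ.antitoneOn hs0.le ht0.le hst) (inv_anti₀ hs0 hst)
          (inv_pos.2 ht0).le (hθ.pos s hs0.le).le
      refine (h2.union hθ.integrableOn).mono_set fun t ht => ?_
      rcases le_or_gt t 1 with h | h
      · exact Or.inl ⟨(Set.mem_Ioi.1 ht).le, h⟩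
      · exact Or.inr h
    have h3 : IntegrableOn (fun t => θ (δ * t) * (δ * t)⁻¹) (Set.Ioi 1) := by
      rw [integrableOn_Ioi_comp_mul_left_iff (fun t => θ t * t⁻¹) 1 hδ, mul_one]
      exact h1
    refine (h3.const_mul (δ ^ 2)).congr (ae_of_all _ fun t => ?_)
    simp only [mul_inv]
    field_simp

/-- Cauchy condensation: the factor `2^q` cancels the `1/t`. This is how the integral condition
enters the construction. -/
theorem IsInghamWeight.summable_two_pow {θ : ℝ → ℝ} (hθ : IsInghamWeight θ) :
    Summable fun q : ℕ => θ (2 ^ q) := by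
  have hanti : AntitoneOn (fun t => θ t * t⁻¹) (Set.Ici ((1 : ℕ) : ℝ)) := by
    intro s hs t ht hst
    have hs0 : (0 : ℝ) < s := lt_of_lt_of_le (by norm_num) (Set.mem_Ici.1 hs)
    have ht0 : 0 < t := hs0.trans_le hst
    exact mul_le_mul (hθ.antitoneOn hs0.le ht0.le hst) (inv_anti₀ hs0 hst)
      (inv_pos.2 ht0).le (hθ.pos s hs0.le).le
  have h := hanti.summable_of_integrableOn_Ioi (by simpa using hθ.integrableOn) fun t ht => by
    have ht0 : (0 : ℝ) < t := lt_trans (by norm_num) (Set.mem_Ioi.1 ht)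
    exact mul_nonneg (hθ.pos t ht0.le).le (inv_pos.2 ht0).le
  have h2 := (summable_condensed_iff_of_nonneg (f := fun i : ℕ => θ i * (i : ℝ)⁻¹)
    (fun i => mul_nonneg (hθ.pos _ (Nat.cast_nonneg i)).le (by positivity))
    (fun i j hi hij => hanti (Set.mem_Ici.2 (by exact_mod_cast hi))
      (Set.mem_Ici.2 (by exact_mod_cast hi.trans_le hij)) (by exact_mod_cast hij))).2 h
  refine h2.congr fun q => ?_
  push_cast
  field_simp

/-- A smooth profile with prescribed support whose iterated twisted Laplacians decay along the
dyadic scales dictated by the weight. -/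
theorem IsInghamWeight.exists_profile {η : ℝ → ℝ} (hη : IsInghamWeight η) (n : ℕ) {r : ℝ}
    (hr : 0 < r) :
    ∃ ψ : ℝ → ℝ, ContDiff ℝ (⊤ : ℕ∞) ψ ∧ (∀ x, 0 ≤ ψ x) ∧ ψ 0 = 1 ∧
      (∀ x, 3 * r < |x| → ψ x = 0) ∧ (∀ x, |ψ x| ≤ 1) ∧
      ∃ q₀ : ℕ, ∀ q, q₀ ≤ q → ∃ m : ℕ, 2 ^ q * η (2 ^ q) + n * q ≤ m ∧
        ∀ s, |(radialTwistedLaplacian n)^[m] ψ s| ≤ (Real.exp (-2) * 4 ^ q) ^ m := by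
  set A : ℝ := 4 * (3 * r) + 4 * (n + 1) + 3 * r / 4 + 1 / 4 with hA
  have hA0 : 0 < A := by positivity
  -- Chosen so that the `m`-th iterate is bounded by `A^m (κ 2^q)^{2m} = (e^{-2} 4^q)^m`.
  set κ : ℝ := Real.exp (-1) / √A with hκ
  have hκ0 : 0 < κ := by positivity
  have hAκ : A * κ ^ 2 = Real.exp (-2) := by
    rw [hκ, div_pow, Real.sq_sqrt hA0.le, ← Real.exp_nat_mul]
    field_simp
    norm_num
  -- The first term yields the required exponential decay; `n * q` pays for the growth of the
  -- Laguerre norms.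
  let m : ℕ → ℕ := fun q => ⌈(2 : ℝ) ^ q * η (2 ^ q)⌉₊ + n * q
  let b : ℕ → ℝ := fun q => κ * 2 ^ q
  have hb0 : ∀ q, 0 < b q := fun q => by positivity
  have hη0 : ∀ q : ℕ, 0 < η (2 ^ q) := fun q => hη.pos _ (by positivity)
  have hS : Summable fun q => ((2 * m q : ℕ) : ℝ) * (2 / b q) := by
    have g1 : Summable fun q : ℕ => (q : ℝ) * (1 / 2) ^ q := by
      simpa using summable_pow_mul_geometric_of_norm_lt_one (R := ℝ) 1 (r := 1 / 2)
        (by rw [Real.norm_eq_abs]; norm_num [abs_of_pos])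
    have g0 : Summable fun q : ℕ => ((1 : ℝ) / 2) ^ q := summable_geometric_two
    have g := ((hη.summable_two_pow.add (g0.add (g1.mul_left (n : ℝ)))).mul_left (4 / κ))
    refine Summable.of_nonneg_of_le (fun q => by positivity) (fun q => ?_) g
    have hc : (⌈(2 : ℝ) ^ q * η (2 ^ q)⌉₊ : ℝ) ≤ 2 ^ q * η (2 ^ q) + 1 :=
      (Nat.ceil_lt_add_one (mul_nonneg (by positivity) (hη0 q).le)).le
    have hp : (0 : ℝ) < 2 ^ q := by positivity
    calc ((2 * m q : ℕ) : ℝ) * (2 / b q)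
        = 4 / κ * ((⌈(2 : ℝ) ^ q * η (2 ^ q)⌉₊ + n * q) / 2 ^ q) := by
          simp only [m, b]; push_cast; field_simp; ring
      _ ≤ 4 / κ * ((2 ^ q * η (2 ^ q) + 1 + n * q) / 2 ^ q) := by gcongr
      _ = _ := by
          rw [div_pow, one_pow]; field_simp; ring
  have htail := tendsto_sum_nat_add fun q => ((2 * m q : ℕ) : ℝ) * (2 / b q)
  have hbig : Tendsto b atTop atTop :=
    (tendsto_pow_atTop_atTop_of_one_lt (by norm_num : (1 : ℝ) < 2)).const_mul_atTop hκ0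
  -- A tail at most `r` controls the support; a tail at most `1` forces `2 * m q ≤ b q`, as the
  -- iterate bound needs along with `1 ≤ b q`.
  obtain ⟨q₀, hq₀, hbq₀⟩ := ((htail.eventually_le_const (lt_min hr one_pos)).and
    (eventually_forall_ge_atTop.2 (hbig.eventually_ge_atTop 1))).exists
  have hS' : Summable fun p => ((2 * m (p + q₀) : ℕ) : ℝ) * (2 / b (p + q₀)) :=
    (summable_nat_add_iff q₀).2 hS
  obtain ⟨ψ, hψ, hψ0, hψ1, hψs, hψb⟩ := exists_contDiff_iteratedDeriv_le hr
    (a := fun p => 2 / b (p + q₀)) (N := fun p => 2 * m (p + q₀))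
    (fun p => div_pos two_pos (hb0 _)) hS' (hq₀.trans (min_le_left _ _))
  refine ⟨ψ, hψ, hψ0, hψ1, hψs, fun x => by simpa using hψb 0 0 (Nat.zero_le _) x, q₀, fun q hq => ?_⟩
  obtain ⟨p, rfl⟩ := Nat.exists_eq_add_of_le' hq
  refine ⟨m (p + q₀), ?_, fun s => ?_⟩
  · simp only [m]
    push_cast
    gcongr
    exact Nat.le_ceil _
  · have hb1 : 1 ≤ b (p + q₀) := hbq₀ _ (by omega)
    have hN : ((2 * m (p + q₀) : ℕ) : ℝ) ≤ b (p + q₀) := by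
      have h1 := hS'.le_tsum p fun i _ => mul_nonneg (Nat.cast_nonneg _)
        (div_pos two_pos (hb0 (i + q₀))).le
      have h2 : ((2 * m (p + q₀) : ℕ) : ℝ) * (2 / b (p + q₀)) ≤ 1 :=
        h1.trans (hq₀.trans (min_le_right _ _))
      rw [← mul_div_assoc, div_le_one (hb0 _)] at h2
      have : (0 : ℝ) ≤ ((2 * m (p + q₀) : ℕ) : ℝ) := Nat.cast_nonneg _
      linarith
    have h := abs_iteratedDeriv_iterate_radialTwistedLaplacian_le (n := n) hψ (R := 3 * r)
      (by positivity) hψs hb1 hN (fun j hj s => by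
        have := hψb p j hj s
        rwa [div_div_cancel₀ two_ne_zero] at this) (m (p + q₀)) 0 (by omega) s
    rw [iteratedDeriv_zero, zero_add] at h
    refine h.trans_eq ?_
    rw [pow_mul, ← mul_pow, ← hAκ]
    congr 1
    simp only [b]
    rw [mul_pow, ← pow_mul, mul_comm _ 2, pow_mul]
    norm_num
    rw [hA]
    ring

end Weights

/-! ### Decay of the twisted convolutions and normalization -/

section Main

variable {n : ℕ}

theorem twistedConv_ofReal_mul_sqRadial (c : ℝ) (f : ℝ → ℝ) (φ : EuclideanSpace ℂ (Fin n) → ℂ) :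
    twistedConv (fun w => ((c * f (‖w‖ ^ 2) : ℝ) : ℂ)) φ = c • twistedConv (sqRadial n f) φ := by
  funext z
  rw [Pi.smul_apply, Complex.real_smul, twistedConv_apply, twistedConv_apply, ← integral_const_mul]
  congr 1; funext w
  simp only [sqRadial]
  push_cast
  ring

/-- The profile of an Ingham function for the weight `η`: smooth, nonnegative, supported near the
origin, with prescribed decay of its twisted convolutions with Laguerre functions. -/
theorem IsInghamWeight.exists_profile_decay {η : ℝ → ℝ} (hη : IsInghamWeight η) (hn : 1 ≤ n) {r : ℝ}
    (hr : 0 < r) :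
    ∃ ψ : ℝ → ℝ, Continuous ψ ∧ (∀ x, 0 ≤ ψ x) ∧ ψ 0 = 1 ∧ (∀ x, 3 * r < x → ψ x = 0) ∧
      ∃ C : ℝ, 0 < C ∧ ∀ k : ℕ,
        eLpNorm (twistedConv (sqRadial n ψ) (laguerreFun n k)) 2 volume ≤
          ENNReal.ofReal
            (C * Real.exp (-(√(2 * (k : ℝ) + n) * η (√(2 * (k : ℝ) + n))))) := by
  obtain ⟨ψ, hψ, hψ0, hψ1, hψs, hψb, q₀, hq₀⟩ := hη.exists_profile n hr
  obtain ⟨L, hL, hLk⟩ := exists_eLpNorm_laguerreFun_le hn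
  have hψs' : ∀ x, 3 * r < x → ψ x = 0 := fun x hx => hψs x (lt_abs.2 (Or.inl hx))
  set V : ℝ := (volume : Measure (EuclideanSpace ℂ (Fin n))).real (Metric.closedBall 0 √(3 * r))
  have hV : 0 ≤ V := measureReal_nonneg
  have hn0 : (0 : ℝ) < n := by exact_mod_cast hn
  -- `C₁` serves the scales `t ≥ 2^q₀`, `C₂` the remaining bounded range, where order `m = 0` is
  -- enough.
  set C₁ : ℝ := V * L * 2 ^ n
  set C₂ : ℝ := V * L * (2 ^ q₀) ^ n * Real.exp (2 ^ q₀ * η 0)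
  have hη0 := hη.pos 0 le_rfl
  refine ⟨ψ, hψ.continuous, hψ0, hψ1, hψs', C₁ + C₂ + 1, by positivity, fun k => ?_⟩
  set t : ℝ := √(2 * (k : ℝ) + n) with ht
  have ht2 : t ^ 2 = 2 * (k : ℝ) + n := Real.sq_sqrt (by positivity)
  have ht1 : 1 ≤ t := by
    rw [ht, ← Real.sqrt_one]
    apply Real.sqrt_le_sqrt
    have h1 : (1 : ℝ) ≤ n := by exact_mod_cast hn
    have h2 : (0 : ℝ) ≤ k := by positivity
    linarith
  have ht0 : 0 < t := by linarith
  have key : ∀ (m : ℕ) (B : ℝ), 0 ≤ B → (∀ s, |(radialTwistedLaplacian n)^[m] ψ s| ≤ B) →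
      eLpNorm (twistedConv (sqRadial n ψ) (laguerreFun n k)) 2 volume ≤
        ENNReal.ofReal (B * V / (t ^ 2) ^ m * (L * t ^ n)) := by
    intro m B hB hBs
    refine (eLpNorm_twistedConv_sqRadial_le hn hψ hψs' hB hBs k).trans ?_
    rw [ENNReal.ofReal_mul (by positivity), ht2]
    gcongr
    exact hLk k
  rcases lt_or_ge t (2 ^ q₀) with hlt | hge
  · refine (key 0 1 zero_le_one (by simpa using hψb)).trans (ENNReal.ofReal_le_ofReal ?_)
    have e1 : t * η t ≤ 2 ^ q₀ * η 0 :=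
      mul_le_mul hlt.le (hη.antitoneOn Set.self_mem_Ici ht0.le ht0.le) (hη.pos t ht0.le).le
        (by positivity)
    calc 1 * V / (t ^ 2) ^ 0 * (L * t ^ n) = V * L * t ^ n := by rw [pow_zero]; ring
      _ ≤ V * L * (2 ^ q₀) ^ n := by gcongr
      _ = C₂ * Real.exp (-(2 ^ q₀ * η 0)) := by
          simp only [C₂]
          rw [mul_assoc _ (Real.exp _), ← Real.exp_add, add_neg_cancel, Real.exp_zero, mul_one]
      _ ≤ (C₁ + C₂ + 1) * Real.exp (-(t * η t)) := by
          have : 0 ≤ C₁ := by positivity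
          gcongr
          linarith
  · obtain ⟨q, hq1, hq2⟩ := exists_nat_pow_near ht1 (by norm_num : (1 : ℝ) < 2)
    have hqq : q₀ ≤ q := by
      have : (2 : ℝ) ^ q₀ < 2 ^ (q + 1) := hge.trans_lt hq2
      have := (pow_lt_pow_iff_right₀ (by norm_num : (1 : ℝ) < 2)).1 this
      omega
    obtain ⟨m, hm, hmB⟩ := hq₀ q hqq
    refine (key m _ (by positivity) hmB).trans (ENNReal.ofReal_le_ofReal ?_)
    have e1 : t * η t ≤ 2 * (2 ^ q * η (2 ^ q)) := by
      calc t * η t ≤ 2 ^ (q + 1) * η (2 ^ q) :=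
            mul_le_mul hq2.le (hη.antitoneOn (Set.mem_Ici.2 (by positivity)) ht0.le hq1)
              (hη.pos t ht0.le).le (by positivity)
        _ = _ := by ring
    have e2 : (4 : ℝ) ^ q ≤ t ^ 2 := by
      calc (4 : ℝ) ^ q = (2 ^ q) ^ 2 := by rw [← pow_mul, mul_comm, pow_mul]; norm_num
        _ ≤ t ^ 2 := by gcongr
    have e3 : (Real.exp (-2) * 4 ^ q) ^ m * V / (t ^ 2) ^ m ≤ Real.exp (-2) ^ m * V := by
      rw [div_le_iff₀ (by positivity), mul_pow]
      calc _ = Real.exp (-2) ^ m * V * (4 ^ q) ^ m := by ring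
        _ ≤ _ := by gcongr
    -- Since `t < 2^(q+1)`, `t η(t)` may be twice `2^q η(2^q)`; this is why the profile was built
    -- with `e^{-2}` instead of `e^{-1}`.
    have e4 : Real.exp (-2) ^ m ≤ Real.exp (-(t * η t)) * Real.exp (-(n * q)) := by
      rw [← Real.exp_nat_mul, ← Real.exp_add]
      apply Real.exp_le_exp.2
      have : (0 : ℝ) ≤ n * q := by positivity
      linarith
    have e5 : t ^ n ≤ 2 ^ n * Real.exp (n * q) := by
      have h2 : (2 : ℝ) ≤ Real.exp 1 := by
        have := Real.add_one_le_exp (1 : ℝ)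
        linarith
      calc t ^ n ≤ (2 ^ (q + 1)) ^ n := by gcongr
        _ = 2 ^ n * 2 ^ (n * q) := by rw [← pow_mul, ← pow_add]; congr 1; ring
        _ ≤ 2 ^ n * Real.exp 1 ^ (n * q) := by gcongr
        _ = _ := by rw [← Real.exp_nat_mul]; push_cast; rw [mul_one]
    have e6 : Real.exp (-(n * q : ℝ)) * Real.exp (n * q) = 1 := by
      rw [← Real.exp_add, neg_add_cancel, Real.exp_zero]
    calc _ ≤ (Real.exp (-(t * η t)) * Real.exp (-(n * q)) * V) * (L * (2 ^ n * Real.exp (n * q))) :=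
          mul_le_mul (e3.trans (by gcongr)) (by gcongr) (by positivity) (by positivity)
      _ = C₁ * Real.exp (-(t * η t)) * (Real.exp (-(n * q : ℝ)) * Real.exp (n * q)) := by
          simp only [C₁]; ring
      _ = C₁ * Real.exp (-(t * η t)) := by rw [e6, mul_one]
      _ ≤ _ := by
          have : 0 ≤ C₂ := by positivity
          gcongr
          linarith

/-- A normalized Ingham function supported in the ball of radius `δ`. -/
theorem IsInghamWeight.exists_normalized {η : ℝ → ℝ} (hη : IsInghamWeight η) (hn : 1 ≤ n) {δ : ℝ}
    (hδ : 0 < δ) :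
    ∃ ρ : EuclideanSpace ℂ (Fin n) → ℝ, Continuous ρ ∧ (∀ w, 0 ≤ ρ w) ∧
      (∀ z w, ‖z‖ = ‖w‖ → ρ z = ρ w) ∧ ∫ w, ρ w = 1 ∧
      tsupport (fun w => (ρ w : ℂ)) ⊆ Metric.ball 0 δ ∧
      ∃ C : ℝ, 0 < C ∧ ∀ k : ℕ,
        eLpNorm (twistedConv (fun w => (ρ w : ℂ)) (laguerreFun n k)) 2 volume ≤
          ENNReal.ofReal
            (C * Real.exp (-(√(2 * (k : ℝ) + n) * η (√(2 * (k : ℝ) + n))))) := by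
  obtain ⟨ψ, hψ, hψ0, hψ1, hψs, C, hC, hCk⟩ :=
    -- The profile lives in `|w|²`, and `3r = 3δ²/4 < δ²` keeps the closed support inside the open
    -- ball.
    hη.exists_profile_decay hn (r := δ ^ 2 / 4) (by positivity)
  let p : EuclideanSpace ℂ (Fin n) → ℝ := fun w => ψ (‖w‖ ^ 2)
  have hp : Continuous p := by fun_prop
  have hps : ∀ w, √(3 * (δ ^ 2 / 4)) < ‖w‖ → p w = 0 := fun w hw =>
    hψs _ (Real.lt_sq_of_sqrt_lt hw)
  have hpc : HasCompactSupport p := HasCompactSupport.intro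
    (isCompact_closedBall 0 √(3 * (δ ^ 2 / 4))) fun w hw => hps w (by simpa using hw)
  have hpi : 0 < ∫ w, p w := hp.integral_pos_of_hasCompactSupport_nonneg_nonzero hpc
    (fun w => hψ0 _) (x := 0) (by simp [p, hψ1])
  set c : ℝ := (∫ w, p w)⁻¹
  have hc : 0 < c := inv_pos.2 hpi
  refine ⟨fun w => c * ψ (‖w‖ ^ 2), by fun_prop, fun w => mul_nonneg hc.le (hψ0 _),
    fun z w h => by simp only [h], ?_, ?_, c * C, by positivity, fun k => ?_⟩
  · rw [integral_const_mul]
    exact inv_mul_cancel₀ hpi.ne'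
  · have hlt : √(3 * (δ ^ 2 / 4)) < δ := by
      rw [Real.sqrt_lt' hδ]
      nlinarith [sq_pos_of_pos hδ]
    refine (closure_minimal ?_ Metric.isClosed_closedBall).trans (Metric.closedBall_subset_ball hlt)
    intro w hw
    by_contra h
    refine hw ?_
    have : ψ (‖w‖ ^ 2) = 0 := hps w (by simpa using h)
    simp only [this, mul_zero, Complex.ofReal_zero]
  · rw [twistedConv_ofReal_mul_sqRadial, eLpNorm_const_smul, Real.enorm_of_nonneg hc.le, mul_assoc,
      ENNReal.ofReal_mul hc.le]
    gcongr
    exact hCk k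

end Main

theorem mainTheorem7 (n : ℕ) (hn : 1 ≤ n) (θ : ℝ → ℝ) (hθ : IsInghamWeight θ) :
    ∃ g : ℝ → EuclideanSpace ℂ (Fin n) → ℂ,
      (∀ δ : ℝ, 0 < δ →
        Integrable (g δ) ∧ IsRadial (g δ) ∧ tsupport (g δ) ⊆ Metric.ball 0 δ) ∧
      (∀ f : EuclideanSpace ℂ (Fin n) → ℂ, Integrable f →
        Tendsto (fun δ : ℝ => eLpNorm (twistedConv f (g δ) - f) 1 volume) (𝓝[>] 0) (𝓝 0)) ∧
      ∀ δ : ℝ, 0 < δ → ∃ θδ : ℝ → ℝ,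
        (∀ t : ℝ, 0 ≤ t → θδ t = δ * θ (δ * t)) ∧ IsInghamWeight θδ ∧
        ∃ C : ℝ, 0 < C ∧ ∀ k : ℕ,
          eLpNorm (twistedConv (g δ) (laguerreFun n k)) 2 volume ≤
            ENNReal.ofReal
              (C * Real.exp (-(√(2 * (k : ℝ) + n) * θδ (√(2 * (k : ℝ) + n))))) := by
  -- For each `δ` the construction uses the dilated weight; the values at `δ ≤ 0` are arbitrary and
  -- play no role.
  choose! ρ hρc hρ0 hρr hρ1 hρs hρd using fun (δ : ℝ) (hδ : 0 < δ) =>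
    (hθ.dilate hδ).exists_normalized hn hδ
  have hout : ∀ δ, 0 < δ → ∀ w, δ ≤ ‖w‖ → ρ δ w = 0 := by
    intro δ hδ w hw
    have h : w ∉ tsupport fun w => (ρ δ w : ℂ) := fun h => by
      have : ‖w‖ < δ := by simpa using hρs δ hδ h
      linarith
    simpa using image_eq_zero_of_notMem_tsupport h
  refine ⟨fun δ w => (ρ δ w : ℂ), fun δ hδ => ⟨?_, fun z w h => ?_, hρs δ hδ⟩, fun f hf => ?_,
    fun δ hδ => ⟨fun t => δ * θ (δ * t), fun t _ => rfl, hθ.dilate hδ, hρd δ hδ⟩⟩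
  · have hs : HasCompactSupport (ρ δ) := HasCompactSupport.intro (isCompact_closedBall 0 δ)
      fun w hw => hout δ hδ w (by
        have : δ < ‖w‖ := by simpa using hw
        exact this.le)
    exact ((hρc δ hδ).integrable_of_hasCompactSupport hs).ofReal
  · simp only [hρr δ hδ z w h]
  · exact tendsto_eLpNorm_twistedConv_sub hρc hρ0 hout hρ1 hf
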